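/- Let $f_0(z)=e^{z/(1-z)}$ and $f_1(z)=e^{x}E_1(x)$ with $x=1/(1-z)$ and $E_1(x)=\int_x^\infty e^{-t}t^{-1}\,dt$, and let $a_n=[z^n]f_0(z)$, $b_n=[z^n]f_1(z)$ be their Maclaurin coefficients. Let $(c_m)_{m\ge 0}$ be the real sequence given by $$c_m=(-1)^m\sum_{j=0}^m\,[h^{m-j}]\exp(\mu(h))\;\frac{(m-2j+3/2)_{2j}}{4^j\,j!},\qquad \mu(h)=\frac1h-\frac1{e^h-1}-\frac12,$$ where $(x)_n=x(x+1)\cdots(x+n-1)$; or let $(c_m)_{m\ge 0}$ be any real sequence for which both asymptotic expansions (in the sense of Poincaré, as $n\to\infty$) $$a_n\sim\frac{e^{2\sqrt n}}{2n^{3/4}\sqrt{\pi e}}\sum_{m\ge0}c_m n^{-m/2},\qquad b_n\sim-\frac{\sqrt{\pi e}}{n^{3/4}e^{2\sqrt n}}\sum_{m\ge0}(-1)^m c_m n^{-m/2}$$ hold. In either case $c_0=1$ and, for all $m\ge1$, $$m\,c_m=[h^{m+3}]\sum_{j=0}^{m-1}c_jh^j\sum_{s\in\{\pm1\}}(1+sh^2)^{\frac{1-2j}{4}}\exp\!\left(\frac2h\left((1+sh^2)^{\frac12}-1\right)\right),$$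 where $[h^k]$ denotes the coefficient of $h^k$ in the power series expansion in $h$. -/

import Mathlib

noncomputable section

namespace ExpIntegral

open PowerSeries

/-! ### The two functions and their Maclaurin coefficients -/

/-- The exponential integral `E₁(x) = ∫_x^∞ e^{-t}/t dt` (used for `x > 0`). -/
def E1 (x : ℝ) : ℝ := ∫ t in Set.Ioi x, Real.exp (-t) / t

/-- `f₀(z) = exp(z/(1-z))`. -/
def f0 (z : ℝ) : ℝ := Real.exp (z / (1 - z))

/-- `f₁(z) = e^x E₁(x)` with `x = 1/(1-z)`. -/
def f1 (z : ℝ) : ℝ := Real.exp (1 / (1 - z)) * E1 (1 / (1 - z))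

/-- The `n`-th Maclaurin coefficient `f⁽ⁿ⁾(0)/n!`. -/
def maclaurin (f : ℝ → ℝ) (n : ℕ) : ℝ := iteratedDeriv n f 0 / (n.factorial : ℝ)

/-- `a_n = [z^n] f₀(z)`. -/
def a (n : ℕ) : ℝ := maclaurin f0 n

/-- `b_n = [z^n] f₁(z)`. -/
def b (n : ℕ) : ℝ := maclaurin f1 n

/-! ### Asymptotic expansions -/

/-- `u n ∼ g n * ∑_{k ≥ 0} e k * n^{-k/2}` as `n → ∞`, in the sense of Poincaré. -/
def HasPoincareExpansion (u g : ℕ → ℝ) (e : ℕ → ℝ) : Prop :=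
  ∀ M : ℕ, 0 < M →
    (fun n : ℕ => u n / g n - ∑ k ∈ Finset.range M, e k * (Real.sqrt n)⁻¹ ^ k)
      =O[Filter.atTop] (fun n : ℕ => (Real.sqrt n)⁻¹ ^ M)

/-- `a_n ∼ e^{2√n} / (2 n^{3/4} √(πe)) * ∑_{m ≥ 0} c_m n^{-m/2}`. -/
def IsExpansionOfA (c : ℕ → ℝ) : Prop :=
  HasPoincareExpansion a
    (fun n : ℕ => Real.exp (2 * Real.sqrt n) /
      (2 * (n : ℝ) ^ (3 / 4 : ℝ) * Real.sqrt (Real.pi * Real.exp 1)))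
    c

/-- `b_n ∼ -√(πe) / (n^{3/4} e^{2√n}) * ∑_{m ≥ 0} (-1)^m c_m n^{-m/2}`. -/
def IsExpansionOfB (c : ℕ → ℝ) : Prop :=
  HasPoincareExpansion b
    (fun n : ℕ => -(Real.sqrt (Real.pi * Real.exp 1) /
      ((n : ℝ) ^ (3 / 4 : ℝ) * Real.exp (2 * Real.sqrt n))))
    (fun m => (-1) ^ m * c m)

/-! ### Formal power series in `h` -/

/-- `(f - f(0)) / h`; for `f(0) = 0` this is the quotient `f / h`. -/
def divX (f : ℝ⟦X⟧) : ℝ⟦X⟧ := PowerSeries.mk fun n => coeff (n + 1) f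

theorem X_mul_divX (f : ℝ⟦X⟧) (hf : constantCoeff f = 0) : X * divX f = f := by
  ext n
  cases n with
  | zero => simp [hf]
  | succ n => simp [divX, coeff_succ_X_mul]

/-- `exp(f)`, for a power series `f` without constant term. -/
def expOf (f : ℝ⟦X⟧) : ℝ⟦X⟧ := (PowerSeries.exp ℝ).subst f

/-- `(1 + s h²)^α`, the binomial series in `s h²`. -/
def onePlusSq (s α : ℝ) : ℝ⟦X⟧ := (PowerSeries.binomialSeries ℝ α).subst (C s * X ^ 2 : ℝ⟦X⟧)

theorem hasSubst_sq (s : ℝ) : HasSubst (C s * X ^ 2 : ℝ⟦X⟧) :=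
  HasSubst.of_constantCoeff_zero' (by simp)

theorem constantCoeff_onePlusSq (s α : ℝ) : constantCoeff (onePlusSq s α) = 1 := by
  have h : PowerSeries.binomialSeries ℝ α = 1 + (PowerSeries.binomialSeries ℝ α - 1) := by ring
  have h0 : constantCoeff (PowerSeries.binomialSeries ℝ α - 1) = 0 := by
    rw [map_sub, ← coeff_zero_eq_constantCoeff_apply, binomialSeries_coeff]
    simp
  have h1 : (1 : ℝ⟦X⟧).subst (C s * X ^ 2 : ℝ⟦X⟧) = (1 : ℝ⟦X⟧) := by
    rw [← coe_substAlgHom (hasSubst_sq s), map_one]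
  rw [onePlusSq, h, subst_add (hasSubst_sq s), map_add, h1]
  have h2 := constantCoeff_subst_eq_zero (a := (C s * X ^ 2 : ℝ⟦X⟧))
    (by exact (by simp : constantCoeff (C s * X ^ 2 : ℝ⟦X⟧) = 0)) _ h0
  have h3 : constantCoeff ((PowerSeries.binomialSeries ℝ α - 1).subst (C s * X ^ 2 : ℝ⟦X⟧)) = 0 := h2
  rw [h3]
  simp

/-- `(2/h) ((1 + s h²)^{1/2} - 1)`. -/
def exponent (s : ℝ) : ℝ⟦X⟧ := C 2 * divX (onePlusSq s (1 / 2) - 1)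

theorem X_mul_exponent (s : ℝ) : X * exponent s = C 2 * (onePlusSq s (1 / 2) - 1) := by
  rw [exponent, mul_left_comm, X_mul_divX]
  simp [constantCoeff_onePlusSq]

/-- `(e^h - 1) / h`. -/
def expm1Div : ℝ⟦X⟧ := divX (PowerSeries.exp ℝ - 1)

/-- `μ(h) = 1/h - 1/(e^h - 1) - 1/2`, written as `(1 - h/(e^h - 1))/h - 1/2`. -/
def mu : ℝ⟦X⟧ := divX (1 - expm1Div⁻¹) - C (1 / 2)

theorem constantCoeff_expm1Div : constantCoeff expm1Div = 1 := by
  rw [← coeff_zero_eq_constantCoeff_apply]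
  simp [expm1Div, divX, coeff_exp, coeff_one]

/-- The equation defining `μ`, with denominators cleared. -/
theorem mu_spec : X * (PowerSeries.exp ℝ - 1) * mu =
    (PowerSeries.exp ℝ - 1) - X - C (1 / 2) * X * (PowerSeries.exp ℝ - 1) := by
  have h1 : X * expm1Div = PowerSeries.exp ℝ - 1 := X_mul_divX _ (by simp)
  have h2 : X * divX (1 - expm1Div⁻¹) = 1 - expm1Div⁻¹ :=
    X_mul_divX _ (by simp [constantCoeff_expm1Div])
  have h3 : expm1Div * expm1Div⁻¹ = 1 :=
    PowerSeries.mul_inv_cancel _ (by simp [constantCoeff_expm1Div])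
  rw [← h1, mu]
  linear_combination X * expm1Div * h2 - X * h3

/-- `μ` has no constant term, so that `exp(μ(h))` is a legitimate substitution. -/
theorem constantCoeff_mu : constantCoeff mu = 0 := by
  have h := congrArg (coeff 2) mu_spec
  have h1 : X * expm1Div = PowerSeries.exp ℝ - 1 := X_mul_divX _ (by simp)
  have e1 : coeff 2 (X * (PowerSeries.exp ℝ - 1) * mu) = constantCoeff mu := by
    rw [← h1, show X * (X * expm1Div) * mu = X ^ 2 * (expm1Div * mu) by ring]
    rw [show (2 : ℕ) = 0 + 2 from rfl, coeff_X_pow_mul]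
    simp [constantCoeff_expm1Div]
  rw [e1, mul_assoc] at h
  rw [h, map_sub, map_sub, coeff_C_mul, show (2 : ℕ) = 1 + 1 from rfl, coeff_succ_X_mul]
  simp [coeff_exp, coeff_one, coeff_X]

/-- The explicit expression
`(-1)^m ∑_{j=0}^m [h^{m-j}] exp(μ(h)) * (m - 2j + 3/2)_{2j} / (4^j j!)`,
with `(x)_n = x (x+1) ⋯ (x+n-1)`. -/
def cDirect (m : ℕ) : ℝ :=
  (-1) ^ m * ∑ j ∈ Finset.range (m + 1),
    coeff (m - j) (expOf mu) *
      ((ascPochhammer ℝ (2 * j)).eval ((m : ℝ) - 2 * (j : ℝ) + 3 / 2) /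
        (4 ^ j * (j.factorial : ℝ)))

end ExpIntegral

end

noncomputable section

namespace ExpIntegral

open PowerSeries

/-! ### Coefficients of the formal series -/

/-! Put `h = n^{-1/2}`. Differentiating the first-order linear equations of `f0` and `f1` gives, for
both coefficient sequences, `(n+1) y_{n+1} + (n-1) y_{n-1} = (2n+1) y_n` (for `b` only when `n ≥
2`). Insert `n^{-3/4} e^{2√n} F(h)` and divide by `n`: with `S_s` the formal shift `n ↦ n + s`, this
is `(1 + h²) S_1 F + (1 - h²) S_{-1} F = (2 + h²) F`. In the coefficient of `h^{m+3}` the unknowns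
`c_{m+3}`, `c_{m+2}`, `c_{m+1}` cancel and `c_m` keeps the factor `-m`; this is the claim
(`recurrence_of_coeff_eq`). It remains to obtain the formal equation in each case.

Explicit sequence: the series is a formal Laplace transform of `exp(μ(-t))`, where `t^k` goes to the
expansion of the Bessel term `n^{-(k+1)/2} I_{k+1}(2√n)`. Shifts become multiplication by `e^{±t}`
(`shift_laplace`), the factor `h²` becomes a differential operator in `t` (`laplace_X_sq_mul`), and
the formal equation becomes a first-order differential equation that `μ` solves
(`derivative_mu_spec`). The value `c_0 = 1` is immediate.

Asymptotic hypothesis: the expansion of `a` is substituted into its recurrence, and uniqueness of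
asymptotic expansions gives the coefficient identity. The recurrence leaves `c_0` free. The
Casoratian of `a` and `b`, equal to 1 after normalisation, forces `c_0² = 1`, and `a_n ≥ 0` fixes
the sign. -/

theorem coeff_expOf {f : ℝ⟦X⟧} (hf : constantCoeff f = 0) {m N : ℕ} (h : m < N) :
    coeff m (expOf f) = ∑ k ∈ Finset.range N, ((k.factorial : ℝ))⁻¹ * coeff m (f ^ k) := by
  rw [expOf, coeff_subst' (HasSubst.of_constantCoeff_zero' hf)]
  rw [finsum_eq_sum_of_support_subset (s := Finset.range N)]
  · refine Finset.sum_congr rfl fun k _ => ?_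
    simp [coeff_exp]
  · intro k hk
    by_contra hk'
    apply hk
    have hk2 : m < k := by simp at hk'; omega
    have : X ^ k ∣ f ^ k := pow_dvd_pow_of_dvd (X_dvd_iff.mpr hf) k
    simp [X_pow_dvd_iff.mp this m hk2]

theorem coeff_onePlusSq (s α : ℝ) (m : ℕ) :
    coeff m (onePlusSq s α) = if Even m then Ring.choose α (m / 2) * s ^ (m / 2) else 0 := by
  rw [onePlusSq, coeff_subst' (hasSubst_sq s)]
  have h : ∀ d : ℕ, coeff m ((C s * X ^ 2 : ℝ⟦X⟧) ^ d) = if m = 2 * d then s ^ d else 0 := by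
    intro d
    rw [mul_pow, ← pow_mul, ← map_pow, coeff_C_mul, coeff_X_pow]
    simp
  simp only [h]
  split_ifs with hm
  · obtain ⟨r, rfl⟩ := hm
    rw [finsum_eq_single _ r]
    · simp [← two_mul]
    · intro d hd
      rw [if_neg (by omega), smul_zero]
  · rw [finsum_eq_zero_of_forall_eq_zero]
    intro d
    rw [if_neg (by rintro rfl; exact hm (even_two_mul d)), smul_zero]

theorem onePlusSq_mul (s α β : ℝ) :
    onePlusSq s α * onePlusSq s β = onePlusSq s (α + β) := by
  rw [onePlusSq, onePlusSq, onePlusSq, binomialSeries_add, subst_mul (hasSubst_sq s)]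

theorem onePlusSq_one (s : ℝ) : onePlusSq s 1 = 1 + C s * X ^ 2 := by
  have h : PowerSeries.binomialSeries ℝ (1 : ℝ) = 1 + X := by
    simpa using binomialSeries_nat (R := ℝ) (A := ℝ) 1
  have h1 : (1 : ℝ⟦X⟧).subst (C s * X ^ 2 : ℝ⟦X⟧) = (1 : ℝ⟦X⟧) := by
    rw [← coe_substAlgHom (hasSubst_sq s), map_one]
  rw [onePlusSq, h, subst_add (hasSubst_sq s), h1, subst_X (hasSubst_sq s)]

theorem constantCoeff_exponent (s : ℝ) : constantCoeff (exponent s) = 0 := by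
  rw [← coeff_zero_eq_constantCoeff_apply, exponent, coeff_C_mul, divX, coeff_mk, map_sub,
    coeff_onePlusSq]
  simp [coeff_one]

theorem constantCoeff_expOf {f : ℝ⟦X⟧} (hf : constantCoeff f = 0) :
    constantCoeff (expOf f) = 1 := by
  rw [← coeff_zero_eq_constantCoeff_apply, coeff_expOf hf zero_lt_one]
  simp

/-! ### Coefficientwise differentiation with respect to a real parameter -/

/-- Every coefficient of `F` is differentiable at `s`, with derivative given by `F'`. -/
def HasCoeffDerivAt (F : ℝ → ℝ⟦X⟧) (F' : ℝ⟦X⟧) (s : ℝ) : Prop :=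
  ∀ m, HasDerivAt (fun t => coeff m (F t)) (coeff m F') s

namespace HasCoeffDerivAt

variable {F G : ℝ → ℝ⟦X⟧} {F' G' : ℝ⟦X⟧} {s : ℝ}

theorem const (f : ℝ⟦X⟧) (s : ℝ) : HasCoeffDerivAt (fun _ => f) 0 s := fun m => by
  simpa using hasDerivAt_const s (coeff m f)

theorem mul (hF : HasCoeffDerivAt F F' s) (hG : HasCoeffDerivAt G G' s) :
    HasCoeffDerivAt (fun t => F t * G t) (F' * G s + F s * G') s := fun m => by
  simp only [map_add, coeff_mul, ← Finset.sum_add_distrib]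
  exact HasDerivAt.fun_sum fun p _ => (hF p.1).mul (hG p.2)

theorem const_mul (f : ℝ⟦X⟧) (hG : HasCoeffDerivAt G G' s) :
    HasCoeffDerivAt (fun t => f * G t) (f * G') s := by
  simpa using (const f s).mul hG

theorem pow (hF : HasCoeffDerivAt F F' s) (k : ℕ) :
    HasCoeffDerivAt (fun t => F t ^ k) (k * F s ^ (k - 1) * F') s := by
  induction k with
  | zero => simpa using const 1 s
  | succ k ih =>
    have h := ih.mul hF
    refine fun m => (h m).congr_deriv ?_
    congr 1
    cases k with
    | zero => simp
    | succ k => push_cast [Nat.add_sub_cancel]; ring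

theorem expOf (hF : HasCoeffDerivAt F F' s) (h0 : ∀ t, constantCoeff (F t) = 0) :
    HasCoeffDerivAt (fun t => expOf (F t)) (expOf (F s) * F') s := fun m => by
  -- One term more than coefficient `m` needs: differentiation kills `k = 0` and lowers the other
  -- powers by one, leaving exactly the `m + 1` terms of the exponential.
  have h1 : (fun t => coeff m (ExpIntegral.expOf (F t))) = fun t =>
      ∑ k ∈ Finset.range (m + 2), ((k.factorial : ℝ))⁻¹ * coeff m (F t ^ k) := by
    funext t
    exact coeff_expOf (h0 t) (by omega)
  have h2 : coeff m (ExpIntegral.expOf (F s) * F') = ∑ k ∈ Finset.range (m + 2),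
      ((k.factorial : ℝ))⁻¹ * coeff m ((k : ℝ⟦X⟧) * F s ^ (k - 1) * F') := by
    rw [Finset.sum_range_succ', coeff_mul]
    have h3 : ∀ p ∈ Finset.HasAntidiagonal.antidiagonal m, coeff p.1 (ExpIntegral.expOf (F s)) * coeff p.2 F' =
        ∑ k ∈ Finset.range (m + 1), ((k.factorial : ℝ))⁻¹ * (coeff p.1 (F s ^ k) * coeff p.2 F') := by
      intro p hp
      have := Finset.HasAntidiagonal.mem_antidiagonal.mp hp
      rw [coeff_expOf (h0 s) (show p.1 < m + 1 by omega), Finset.sum_mul]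
      exact Finset.sum_congr rfl fun k _ => by ring
    rw [Finset.sum_congr rfl h3, Finset.sum_comm]
    simp only [← Finset.mul_sum, ← coeff_mul]
    simp only [Nat.cast_zero, zero_mul, map_zero, mul_zero, add_zero]
    refine Finset.sum_congr rfl fun k _ => ?_
    rw [Nat.add_sub_cancel, mul_assoc, ← map_natCast (C (R := ℝ)), coeff_C_mul,
      Nat.factorial_succ]
    push_cast
    field_simp
  rw [h1, h2]
  exact HasDerivAt.fun_sum fun k _ => (hF.pow k m).const_mul _

end HasCoeffDerivAt

/-- Peel the first factor off the falling factorial. This is the coefficient form of differentiating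
a binomial series. -/
theorem choose_succ_mul (α : ℝ) (k : ℕ) :
    Ring.choose α (k + 1) * (k + 1 : ℝ) = α * Ring.choose (α - 1) k := by
  have h := Ring.descPochhammer_eq_factorial_smul_choose α (k + 1)
  have h' := Ring.descPochhammer_eq_factorial_smul_choose (α - 1) k
  rw [descPochhammer_succ_left, Polynomial.smeval_X_mul, Polynomial.smeval_comp] at h
  simp only [Polynomial.smeval_sub, Polynomial.smeval_X, Polynomial.smeval_one, pow_one, pow_zero,
    one_smul, nsmul_eq_mul] at h h'
  rw [h', Nat.factorial_succ] at h
  have hk : (k.factorial : ℝ) ≠ 0 := by positivity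
  apply mul_left_cancel₀ hk
  push_cast at h
  linear_combination -h

theorem hasCoeffDerivAt_onePlusSq (s α : ℝ) :
    HasCoeffDerivAt (fun t => onePlusSq t α) (C α * X ^ 2 * onePlusSq s (α - 1)) s := fun m => by
  simp only [coeff_onePlusSq, mul_assoc, coeff_C_mul, coeff_X_pow_mul']
  by_cases hm : Even m
  · obtain ⟨r, rfl⟩ := hm
    cases r with
    | zero => simpa using hasDerivAt_const s _
    | succ r =>
      have e1 : Even (r + 1 + (r + 1)) := ⟨r + 1, rfl⟩
      have e2 : Even (r + 1 + (r + 1) - 2) := ⟨r, by omega⟩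
      have e3 : (r + 1 + (r + 1)) / 2 = r + 1 := by omega
      have e4 : (r + 1 + (r + 1) - 2) / 2 = r := by omega
      simp only [if_pos e1, if_pos e2, e3, e4, if_pos (show 2 ≤ r + 1 + (r + 1) by omega)]
      have := (hasDerivAt_pow (r + 1) s).const_mul (Ring.choose α (r + 1))
      refine this.congr_deriv ?_
      rw [Nat.add_sub_cancel]
      push_cast
      linear_combination s ^ r * choose_succ_mul α r
  · have e2 : ¬ (2 ≤ m ∧ Even (m - 2)) := by
      rintro ⟨h, r, hr⟩
      exact hm ⟨r + 1, by omega⟩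
    have : (if 2 ≤ m then if Even (m - 2) then
        Ring.choose (α - 1) ((m - 2) / 2) * s ^ ((m - 2) / 2) else 0 else 0) = 0 := by
      split_ifs with h1 h2
      · exact absurd ⟨h1, h2⟩ e2
      · rfl
      · rfl
    simp only [if_neg hm, this, mul_zero]
    exact hasDerivAt_const s _

theorem hasCoeffDerivAt_exponent (s : ℝ) :
    HasCoeffDerivAt exponent (X * onePlusSq s (-1 / 2)) s := fun m => by
  have h := (hasCoeffDerivAt_onePlusSq s (1 / 2) (m + 1)).const_mul 2
  have h2 : (fun t => coeff m (exponent t)) = fun t => 2 * coeff (m + 1) (onePlusSq t (1 / 2)) := by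
    funext t
    simp [exponent, divX, coeff_one]
  rw [h2]
  refine h.congr_deriv ?_
  rw [mul_assoc, coeff_C_mul, pow_two, mul_assoc, coeff_succ_X_mul]
  norm_num
  ring

/-! ### The effect of a shift on formal powers -/

/-- The formal expansion of `(n + s)^{-3/4 - j/2} e^{2 √(n + s)}` divided by `n^{-3/4} e^{2 √n}`,
in powers of `h = n^{-1/2}`. -/
def shiftPow (j : ℕ) (s : ℝ) : ℝ⟦X⟧ :=
  X ^ j * (onePlusSq s (-3 / 4 - j / 2) * expOf (exponent s))

/-- Differentiating the factor `e^{2√(n+s)}` brings down `(n+s)^{-1/2}`, raising `j` by one;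
differentiating the power brings down `-(3/4 + j/2)(n+s)^{-1}`, raising `j` by two. -/
theorem hasCoeffDerivAt_shiftPow (j : ℕ) (s : ℝ) :
    HasCoeffDerivAt (shiftPow j)
      (shiftPow (j + 1) s - C (3 / 4 + j / 2 : ℝ) * shiftPow (j + 2) s) s := by
  have h := ((hasCoeffDerivAt_onePlusSq s (-3 / 4 - j / 2)).mul
    ((hasCoeffDerivAt_exponent s).expOf constantCoeff_exponent)).const_mul (X ^ j)
  change HasCoeffDerivAt (fun t => X ^ j * (onePlusSq t (-3 / 4 - j / 2) * expOf (exponent t))) _ _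
  refine fun m => (h m).congr_deriv (congrArg (coeff m) ?_)
  have e1 : onePlusSq s (-3 / 4 - ((j + 1 : ℕ) : ℝ) / 2) =
      onePlusSq s (-3 / 4 - j / 2) * onePlusSq s (-1 / 2) := by
    rw [onePlusSq_mul]; congr 1; push_cast; ring
  have e2 : onePlusSq s (-3 / 4 - ((j + 2 : ℕ) : ℝ) / 2) =
      onePlusSq s (-3 / 4 - (j : ℝ) / 2 - 1) := by
    congr 1; push_cast; ring
  have e3 : C (3 / 4 + j / 2 : ℝ) = - C (-3 / 4 - j / 2 : ℝ) := by
    rw [← map_neg]; congr 1; ring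
  rw [shiftPow, shiftPow, e1, e2, e3]
  ring

theorem coeff_shiftPow_of_lt {j m : ℕ} (h : m < j) (s : ℝ) : coeff m (shiftPow j s) = 0 := by
  rw [shiftPow, coeff_X_pow_mul', if_neg (by omega)]

theorem expOf_zero : expOf 0 = 1 := by
  ext m
  rw [coeff_expOf (by simp) (Nat.lt_succ_self m), Finset.sum_range_succ']
  simp

theorem onePlusSq_zero_left (α : ℝ) : onePlusSq 0 α = 1 := by
  ext m
  rw [coeff_onePlusSq, coeff_one]
  rcases m with _ | _ | m
  · simp
  · simp
  · have : (m + 1 + 1) / 2 = m / 2 + 1 := by omega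
    simp [this]

theorem shiftPow_zero_right (j : ℕ) : shiftPow j 0 = X ^ j := by
  have : exponent 0 = 0 := by
    ext m
    simp [exponent, divX, onePlusSq_zero_left]
  rw [shiftPow, this, expOf_zero, onePlusSq_zero_left]
  simp

/-! ### From a formal identity to the recurrence -/

/-- The symmetrised shift series `∑_{s = ±1} (1 + s h²)^{(1-2j)/4} exp((2/h)((1 + s h²)^{1/2} - 1))`. -/
def symShift (j : ℕ) : ℝ⟦X⟧ :=
  ∑ s ∈ ({1, -1} : Finset ℝ), onePlusSq s ((1 - 2 * (j : ℝ)) / 4) * expOf (exponent s)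

/-- The exponent starts `s h - s² h³/4`, so its exponential is `1 + s h + s² h²/2 + (s³/6 - s²/4) h³
+ ⋯`; multiply by `1 + α s h² + ⋯`. -/
theorem coeff_onePlusSq_mul_expOf (s α : ℝ) :
    coeff 0 (onePlusSq s α * expOf (exponent s)) = 1 ∧
    coeff 1 (onePlusSq s α * expOf (exponent s)) = s ∧
    coeff 2 (onePlusSq s α * expOf (exponent s)) = s ^ 2 / 2 + α * s ∧
    coeff 3 (onePlusSq s α * expOf (exponent s)) = -s ^ 2 / 4 + s ^ 3 / 6 + α * s ^ 2 := by
  have c2 : Ring.choose (1 / 2 : ℝ) 2 = -1 / 8 := by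
    have := choose_succ_mul (1 / 2 : ℝ) 1
    rw [Ring.choose_one_right] at this
    norm_num at this
    norm_num
    linarith
  have o0 : ∀ β, coeff 0 (onePlusSq s β) = 1 := fun β => by simp [coeff_onePlusSq]
  have o1 : ∀ β, coeff 1 (onePlusSq s β) = 0 := fun β => by simp [coeff_onePlusSq]
  have o2 : ∀ β, coeff 2 (onePlusSq s β) = β * s := fun β => by simp [coeff_onePlusSq]
  have o3 : ∀ β, coeff 3 (onePlusSq s β) = 0 := fun β => by
    rw [coeff_onePlusSq, if_neg (by decide)]
  have o4 : coeff 4 (onePlusSq s (1 / 2)) = -1 / 8 * s ^ 2 := by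
    rw [coeff_onePlusSq, if_pos (by decide), c2]
  have e : ∀ n, coeff n (exponent s) = 2 * (coeff (n + 1) (onePlusSq s (1 / 2))) := fun n => by
    simp [exponent, divX, coeff_one]
  have e0 : coeff 0 (exponent s) = 0 := by rw [e, o1]; ring
  have e1 : coeff 1 (exponent s) = s := by rw [e, o2]; ring
  have e2 : coeff 2 (exponent s) = 0 := by rw [e, o3]; ring
  have e3 : coeff 3 (exponent s) = -s ^ 2 / 4 := by rw [e, o4]; ring
  have x : ∀ m < 4, coeff m (expOf (exponent s)) = _ := fun m hm =>
    coeff_expOf (constantCoeff_exponent s) hm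
  have x0 : coeff 0 (expOf (exponent s)) = 1 := by
    simpa using constantCoeff_expOf (constantCoeff_exponent s)
  have x1 : coeff 1 (expOf (exponent s)) = s := by
    rw [x 1 (by norm_num)]
    simp [-coeff_zero_eq_constantCoeff, Finset.sum_range_succ, pow_succ, coeff_mul,
      Finset.Nat.antidiagonal_succ, e0, e1, coeff_one]
  have x2 : coeff 2 (expOf (exponent s)) = s ^ 2 / 2 := by
    rw [x 2 (by norm_num)]
    simp [-coeff_zero_eq_constantCoeff, Finset.sum_range_succ, pow_succ, coeff_mul,
      Finset.Nat.antidiagonal_succ, e0, e1, e2, coeff_one]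
    ring
  have x3 : coeff 3 (expOf (exponent s)) = -s ^ 2 / 4 + s ^ 3 / 6 := by
    rw [x 3 (by norm_num)]
    simp [-coeff_zero_eq_constantCoeff, Finset.sum_range_succ, pow_succ, coeff_mul,
      Finset.Nat.antidiagonal_succ, e0, e1, e2, e3, coeff_one, Nat.factorial]
    ring
  refine ⟨?_, ?_, ?_, ?_⟩ <;>
    simp [-coeff_zero_eq_constantCoeff, coeff_mul, Finset.Nat.antidiagonal_succ, o0, o1, o2, o3,
      x0, x1, x2, x3]
  ring

/-- Odd powers of `s` cancel in the sum over signs. At `h³` there remains `2(α - 1/4)` with `α = (1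
- 2j)/4`, the origin of the factor `m` in the recurrence. -/
theorem coeff_symShift (j : ℕ) : coeff 0 (symShift j) = 2 ∧ coeff 1 (symShift j) = 0 ∧
    coeff 2 (symShift j) = 1 ∧ coeff 3 (symShift j) = -j := by
  have h : ∀ s, _ := fun s => coeff_onePlusSq_mul_expOf s ((1 - 2 * (j : ℝ)) / 4)
  rw [symShift, Finset.sum_pair (show (1 : ℝ) ≠ -1 by norm_num)]
  refine ⟨?_, ?_, ?_, ?_⟩
  · rw [map_add, (h 1).1, (h (-1)).1]; norm_num
  · rw [map_add, (h 1).2.1, (h (-1)).2.1]; norm_num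
  · rw [map_add, (h 1).2.2.1, (h (-1)).2.2.1]; ring
  · rw [map_add, (h 1).2.2.2, (h (-1)).2.2.2]; ring

/-- The indices `j = m+3, m+2, m+1, m` contribute `2c_{m+3}`, `0`, `c_{m+1}` and `-m c_m`. The first
three match the right-hand side. -/
theorem recurrence_of_coeff_eq {c : ℕ → ℝ} {m : ℕ}
    (h : coeff (m + 3) (∑ j ∈ Finset.range (m + 4), C (c j) * X ^ j * symShift j) =
      coeff (m + 3) ((2 + X ^ 2) * mk c)) :
    (m : ℝ) * c m = coeff (m + 3) (∑ j ∈ Finset.range m, C (c j) * X ^ j * symShift j) := by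
  have e : ∀ i k, coeff (k + i) (C (c i) * X ^ i * symShift i) = c i * coeff k (symShift i) := by
    intro i k
    rw [mul_assoc, coeff_C_mul, coeff_X_pow_mul]
  have h1 := e m 3
  have h2 := e (m + 1) 2
  have h3 := e (m + 2) 1
  have h4 := e (m + 3) 0
  rw [(coeff_symShift _).2.2.2, add_comm 3 m] at h1
  rw [(coeff_symShift _).2.2.1, show 2 + (m + 1) = m + 3 by ring] at h2
  rw [(coeff_symShift _).2.1, show 1 + (m + 2) = m + 3 by ring] at h3
  rw [(coeff_symShift _).1, zero_add] at h4
  have h5 : coeff (m + 3) ((2 + X ^ 2) * mk c) = 2 * c (m + 3) + c (m + 1) := by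
    rw [show (2 : ℝ⟦X⟧) = C 2 from (map_ofNat C 2).symm, add_mul, map_add, coeff_C_mul, coeff_mk,
      show m + 3 = m + 1 + 2 by ring, coeff_X_pow_mul, coeff_mk]
  rw [Finset.sum_range_succ, Finset.sum_range_succ, Finset.sum_range_succ,
    Finset.sum_range_succ, map_add, map_add, map_add, map_add, h1, h2, h3, h4, h5] at h
  linarith

/-! ### The formal shift operator -/

/-- The formal shift `n ↦ n + s` acting on `n^{-3/4} e^{2 √n} f(n^{-1/2})`. -/
def shift (s : ℝ) (f : ℝ⟦X⟧) : ℝ⟦X⟧ :=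
  mk fun m => ∑ j ∈ Finset.range (m + 1), coeff j f * coeff m (shiftPow j s)

theorem coeff_shift {m N : ℕ} (h : m < N) (s : ℝ) (f : ℝ⟦X⟧) :
    coeff m (shift s f) = ∑ j ∈ Finset.range N, coeff j f * coeff m (shiftPow j s) := by
  rw [shift, coeff_mk]
  refine Finset.sum_subset (Finset.range_subset_range.mpr h) fun j _ hj => ?_
  rw [coeff_shiftPow_of_lt (by simpa using hj), mul_zero]

theorem shift_zero_left (f : ℝ⟦X⟧) : shift 0 f = f := by
  ext m
  rw [coeff_shift (Nat.lt_succ_self m), Finset.sum_eq_single m]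
  · simp [shiftPow_zero_right, coeff_X_pow]
  · intro j _ hj
    simp [shiftPow_zero_right, coeff_X_pow, hj.symm]
  · simp

/-- Differentiation with respect to `n` acting on `n^{-3/4} e^{2 √n} f(n^{-1/2})`. -/
def shiftGen (f : ℝ⟦X⟧) : ℝ⟦X⟧ :=
  X * f - C (3 / 4) * (X ^ 2 * f) - C (1 / 2) * (X ^ 3 * d⁄dX ℝ f)

/-- The shift is formally `exp(s d/dn)`, so its derivative in `s` applies the generator first. -/
theorem hasCoeffDerivAt_shift (s : ℝ) (f : ℝ⟦X⟧) :
    HasCoeffDerivAt (fun t => shift t f) (shift s (shiftGen f)) s := fun m => by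
  have h1 : (fun t => coeff m (shift t f)) = fun t =>
      ∑ j ∈ Finset.range (m + 1), coeff j f * coeff m (shiftPow j t) := by
    funext t
    exact coeff_shift (Nat.lt_succ_self m) t f
  have g0 : coeff 0 (shiftGen f) = 0 := by
    simp [shiftGen]
  have g : ∀ j, coeff (j + 1) (shiftGen f) =
      coeff j f - if j = 0 then 0 else (3 / 4 + (j - 1 : ℕ) / 2) * coeff (j - 1) f := by
    intro j
    rw [shiftGen, map_sub, map_sub, coeff_C_mul, coeff_C_mul, coeff_succ_X_mul]
    rcases j with _ | _ | j
    · simp [coeff_X_pow_mul']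
    · simp [coeff_X_pow_mul']
    · rw [coeff_X_pow_mul', coeff_X_pow_mul', if_pos (by omega), if_pos (by omega), if_neg (by omega),
        show j + 1 + 1 + 1 - 3 = j by omega, coeff_derivative]
      simp only [show j + 1 + 1 + 1 - 2 = j + 1 by omega, show j + 1 + 1 - 1 = j + 1 by omega]
      push_cast
      ring
  have h2 : coeff m (shift s (shiftGen f)) = ∑ j ∈ Finset.range (m + 1),
      coeff j f * coeff m (shiftPow (j + 1) s - C (3 / 4 + j / 2 : ℝ) * shiftPow (j + 2) s) := by
    -- The two spare indices absorb the moves `j ↦ j+1` and `j ↦ j+2`; the surplus terms vanish.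
    rw [coeff_shift (show m < m + 2 + 1 by omega), Finset.sum_range_succ', g0, zero_mul, add_zero]
    simp only [g, sub_mul, mul_sub, map_sub, Finset.sum_sub_distrib]
    congr 1
    · rw [Finset.sum_range_succ, coeff_shiftPow_of_lt (show m < m + 1 + 1 by omega), mul_zero,
        add_zero]
    · rw [Finset.sum_range_succ', if_pos rfl, zero_mul, add_zero]
      refine Finset.sum_congr rfl fun j _ => ?_
      rw [if_neg (by omega), Nat.add_sub_cancel, coeff_C_mul]
      ring
  rw [h1, h2]
  exact HasDerivAt.fun_sum fun j _ => (hasCoeffDerivAt_shiftPow j s m).const_mul _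

/-! ### The formal Laplace transform -/

/-- The coefficients of the expansion of `√(2π x) e^{-x} I_{k+1}(x)`, `x = 2 √n`, in powers of
`n^{-1/2}`. -/
def besselCoeff (k j : ℕ) : ℝ :=
  (-1) ^ j * ((ascPochhammer ℝ (2 * j)).eval ((k : ℝ) - j + 3 / 2) / (4 ^ j * (j.factorial : ℝ)))

theorem besselCoeff_zero (k : ℕ) : besselCoeff k 0 = 1 := by simp [besselCoeff]

theorem eval_ascPochhammer_succ_left (n : ℕ) (y : ℝ) :
    (ascPochhammer ℝ (n + 1)).eval y = y * (ascPochhammer ℝ n).eval (y + 1) := by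
  rw [ascPochhammer_succ_left]; simp

/-- Coefficient form of `d/dn (n^{-ν/2} I_ν(2√n)) = n^{-(ν+1)/2} I_{ν+1}(2√n)`, with `ν = k + 1`. -/
theorem besselCoeff_succ_left (k j : ℕ) :
    besselCoeff (k + 1) (j + 1) =
      besselCoeff k (j + 1) - (3 / 4 + (k + j : ℝ) / 2) * besselCoeff k j := by
  have a1 : (ascPochhammer ℝ (2 * (j + 1))).eval (((k + 1 : ℕ) : ℝ) - (j + 1 : ℕ) + 3 / 2) =
      (ascPochhammer ℝ (2 * j)).eval ((k : ℝ) - j + 3 / 2) *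
        ((k + j + 3 / 2) * (k + j + 5 / 2)) := by
    rw [show 2 * (j + 1) = 2 * j + 1 + 1 by ring, ascPochhammer_succ_eval, ascPochhammer_succ_eval,
      show ((k + 1 : ℕ) : ℝ) - (j + 1 : ℕ) + 3 / 2 = (k : ℝ) - j + 3 / 2 by push_cast; ring]
    push_cast
    ring
  have a2 : (ascPochhammer ℝ (2 * (j + 1))).eval ((k : ℝ) - (j + 1 : ℕ) + 3 / 2) =
      (ascPochhammer ℝ (2 * j)).eval ((k : ℝ) - j + 3 / 2) *
        ((k - j + 1 / 2) * (k + j + 3 / 2)) := by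
    rw [show 2 * (j + 1) = 2 * j + 1 + 1 by ring, eval_ascPochhammer_succ_left,
      ascPochhammer_succ_eval,
      show (k : ℝ) - (j + 1 : ℕ) + 3 / 2 + 1 = (k : ℝ) - j + 3 / 2 by push_cast; ring]
    push_cast
    ring
  rw [besselCoeff, besselCoeff, besselCoeff, a1, a2, Nat.factorial_succ]
  have hj : (j.factorial : ℝ) ≠ 0 := by positivity
  have hj1 : (j + 1 : ℝ) ≠ 0 := by positivity
  push_cast
  field_simp
  ring

/-- Coefficient form of `I_{ν+1}(x) = I_{ν-1}(x) - (2ν/x) I_ν(x)` at `ν = k + 2`, `x = 2√n`. -/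
theorem besselCoeff_add_two (k j : ℕ) :
    besselCoeff (k + 2) (j + 1) =
      besselCoeff k (j + 1) - (k + 2 : ℝ) * besselCoeff (k + 1) j := by
  have a1 : (ascPochhammer ℝ (2 * (j + 1))).eval (((k + 2 : ℕ) : ℝ) - (j + 1 : ℕ) + 3 / 2) =
      (ascPochhammer ℝ (2 * j)).eval (((k + 1 : ℕ) : ℝ) - j + 3 / 2) *
        ((k + j + 5 / 2) * (k + j + 7 / 2)) := by
    rw [show 2 * (j + 1) = 2 * j + 1 + 1 by ring, ascPochhammer_succ_eval, ascPochhammer_succ_eval,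
      show ((k + 2 : ℕ) : ℝ) - (j + 1 : ℕ) + 3 / 2 = ((k + 1 : ℕ) : ℝ) - j + 3 / 2 by
        push_cast; ring]
    push_cast
    ring
  have a2 : (ascPochhammer ℝ (2 * (j + 1))).eval ((k : ℝ) - (j + 1 : ℕ) + 3 / 2) =
      (ascPochhammer ℝ (2 * j)).eval (((k + 1 : ℕ) : ℝ) - j + 3 / 2) *
        ((k - j + 1 / 2) * (k - j + 3 / 2)) := by
    rw [show 2 * (j + 1) = 2 * j + 1 + 1 by ring, eval_ascPochhammer_succ_left,
      eval_ascPochhammer_succ_left,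
      show (k : ℝ) - (j + 1 : ℕ) + 3 / 2 + 1 + 1 = ((k + 1 : ℕ) : ℝ) - j + 3 / 2 by
        push_cast; ring]
    push_cast
    ring
  rw [besselCoeff, besselCoeff, besselCoeff, a1, a2, Nat.factorial_succ]
  have hj : (j.factorial : ℝ) ≠ 0 := by positivity
  have hj1 : (j + 1 : ℝ) ≠ 0 := by positivity
  push_cast
  field_simp
  ring

/-- The linear map sending `t^k` to the expansion of
`n^{-(k+1)/2} I_{k+1}(2 √n)`, normalised by `n^{-3/4} e^{2 √n} / (2 √π)`, in powers of `n^{-1/2}`. -/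
def laplace : ℝ⟦X⟧ →ₗ[ℝ] ℝ⟦X⟧ where
  toFun g := mk fun m => ∑ p ∈ Finset.HasAntidiagonal.antidiagonal m,
    coeff p.1 g * besselCoeff p.1 p.2
  map_add' f g := by
    ext m
    simp [add_mul, Finset.sum_add_distrib]
  map_smul' r g := by
    ext m
    simp [Finset.mul_sum, mul_assoc]

theorem coeff_laplace (m : ℕ) (g : ℝ⟦X⟧) :
    coeff m (laplace g) = ∑ p ∈ Finset.HasAntidiagonal.antidiagonal m,
      coeff p.1 g * besselCoeff p.1 p.2 :=
  coeff_mk m fun m => ∑ p ∈ Finset.HasAntidiagonal.antidiagonal m,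
    coeff p.1 g * besselCoeff p.1 p.2

/-- Multiplication by `t` corresponds to `d/dn`: the Bessel derivative formula summed over
antidiagonals. -/
theorem laplace_X_mul (g : ℝ⟦X⟧) : laplace (X * g) = shiftGen (laplace g) := by
  ext m
  rcases m with _ | m
  · simp [coeff_laplace, shiftGen]
  rw [coeff_laplace, Finset.Nat.sum_antidiagonal_succ]
  simp only [coeff_zero_X_mul, zero_mul, zero_add, coeff_succ_X_mul]
  rw [shiftGen, map_sub, map_sub, coeff_C_mul, coeff_C_mul, coeff_succ_X_mul]
  rcases m with _ | m
  · simp [coeff_laplace, coeff_X_pow_mul', besselCoeff_zero]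
  have e2 : coeff (m + 1 + 1) (X ^ 2 * laplace g) = coeff m (laplace g) :=
    coeff_X_pow_mul (laplace g) 2 m
  have e3 : coeff (m + 1 + 1) (X ^ 3 * d⁄dX ℝ (laplace g)) = m * coeff m (laplace g) := by
    rw [coeff_X_pow_mul']
    rcases m with _ | m
    · simp
    · rw [if_pos (by omega), show m + 1 + 1 + 1 - 3 = m by omega, coeff_derivative]
      push_cast
      ring
  rw [e2, e3, coeff_laplace, coeff_laplace, Finset.Nat.sum_antidiagonal_succ',
    Finset.Nat.sum_antidiagonal_succ', besselCoeff_zero, besselCoeff_zero, sub_sub, add_sub_assoc]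
  congr 1
  rw [← mul_assoc, ← add_mul, Finset.mul_sum, ← Finset.sum_sub_distrib]
  refine Finset.sum_congr rfl fun p hp => ?_
  have hp := Finset.HasAntidiagonal.mem_antidiagonal.mp hp
  rw [besselCoeff_succ_left, ← hp]
  push_cast
  ring

/-- The three-term Bessel relation, `(k+2) t^{k+1}` being the derivative of `t^{k+2}`. It trades a
factor `h²` for a differential operator in `t`. -/
theorem laplace_X_sq_mul (g : ℝ⟦X⟧) :
    laplace (X ^ 2 * g) = X ^ 2 * (laplace g - laplace (d⁄dX ℝ (X ^ 2 * g))) := by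
  ext m
  rcases m with _ | _ | m
  · simp [coeff_laplace]
  · simp [coeff_laplace, Finset.Nat.antidiagonal_succ, coeff_X_pow_mul']
  rw [show m + 1 + 1 = m + 2 by ring, coeff_X_pow_mul, coeff_laplace,
    Finset.Nat.sum_antidiagonal_succ, Finset.Nat.sum_antidiagonal_succ]
  have e0 : coeff 0 (X ^ 2 * g) = 0 := by simp
  have e1 : coeff (0 + 1) (X ^ 2 * g) = 0 := by simp [coeff_X_pow_mul']
  have e2 : ∀ k, coeff (k + 1 + 1) (X ^ 2 * g) = coeff k g := fun k => coeff_X_pow_mul g 2 k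
  simp only [e0, e1, e2, zero_mul, zero_add]
  rw [map_sub, coeff_laplace, coeff_laplace]
  simp only [coeff_derivative]
  rcases m with _ | m
  · simp [besselCoeff_zero, coeff_X_pow_mul']
  rw [Finset.Nat.sum_antidiagonal_succ', Finset.Nat.sum_antidiagonal_succ',
    Finset.Nat.sum_antidiagonal_succ (f := fun p : ℕ × ℕ =>
      coeff (p.1 + 1) (X ^ 2 * g) * ((p.1 : ℝ) + 1) * besselCoeff p.1 p.2)]
  simp only [e1, e2, zero_mul, zero_add, besselCoeff_zero]
  rw [add_sub_assoc]
  congr 1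
  rw [← Finset.sum_sub_distrib]
  refine Finset.sum_congr rfl fun p _ => ?_
  rw [show p.1 + 1 + 1 = p.1 + 2 by ring, besselCoeff_add_two]
  push_cast
  ring

theorem coeff_laplace_X_pow_mul_of_lt {k m : ℕ} (h : m < k) (g : ℝ⟦X⟧) :
    coeff m (laplace (X ^ k * g)) = 0 := by
  rw [coeff_laplace]
  refine Finset.sum_eq_zero fun p hp => ?_
  have := Finset.HasAntidiagonal.mem_antidiagonal.mp hp
  rw [coeff_X_pow_mul', if_neg (by omega), zero_mul]

theorem coeff_shift_of_lt {k m : ℕ} (h : m < k) (s : ℝ) {f : ℝ⟦X⟧}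
    (hf : ∀ j < k, coeff j f = 0) : coeff m (shift s f) = 0 := by
  rw [coeff_shift (Nat.lt_succ_self m)]
  refine Finset.sum_eq_zero fun j hj => ?_
  rw [hf j (by simp at hj; omega), zero_mul]

theorem hasCoeffDerivAt_rescale_exp (s : ℝ) :
    HasCoeffDerivAt (fun t => rescale t (PowerSeries.exp ℝ))
      (X * rescale s (PowerSeries.exp ℝ)) s := fun m => by
  simp only [coeff_rescale]
  rcases m with _ | m
  · simpa using hasDerivAt_const s _
  · rw [coeff_succ_X_mul, coeff_rescale]
    refine ((hasDerivAt_pow (m + 1) s).mul_const _).congr_deriv ?_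
    simp only [coeff_exp, Nat.factorial_succ]
    push_cast
    simp
    field_simp

theorem HasCoeffDerivAt.laplace {F : ℝ → ℝ⟦X⟧} {F' : ℝ⟦X⟧} {s : ℝ} (h : HasCoeffDerivAt F F' s) :
    HasCoeffDerivAt (fun t => laplace (F t)) (laplace F') s := fun m => by
  simp only [coeff_laplace]
  exact HasDerivAt.fun_sum fun p _ => (h p.1).mul_const _

/-- Multiplication by `e^{s t}` corresponds to the shift `n ↦ n + s`. -/
theorem shift_laplace (s : ℝ) (g : ℝ⟦X⟧) :
    shift s (laplace g) = laplace (rescale s (PowerSeries.exp ℝ) * g) := by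
  -- Induction on the gap `d`. For `d = 0` both sides start beyond `h^m`. Otherwise their difference
  -- has zero derivative in `t`, by the case `k + 1`, and vanishes at `t = 0`.
  have key : ∀ m d k : ℕ, m < k + d → ∀ t, coeff m (shift t (laplace (X ^ k * g))) =
      coeff m (laplace (rescale t (PowerSeries.exp ℝ) * (X ^ k * g))) := by
    intro m d
    induction d with
    | zero =>
      intro k hk t
      rw [coeff_shift_of_lt (show m < k by omega) t
        (fun j hj => coeff_laplace_X_pow_mul_of_lt hj g), mul_left_comm,
        coeff_laplace_X_pow_mul_of_lt (by omega)]
    | succ d ih =>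
      intro k hk
      have hd : ∀ t, HasDerivAt (fun t => coeff m (shift t (laplace (X ^ k * g))) -
          coeff m (laplace (rescale t (PowerSeries.exp ℝ) * (X ^ k * g)))) 0 t := by
        intro t
        have h1 := hasCoeffDerivAt_shift t (laplace (X ^ k * g)) m
        have h2 := ((hasCoeffDerivAt_rescale_exp t).mul
          (HasCoeffDerivAt.const (X ^ k * g) t)).laplace m
        refine (h1.sub h2).congr_deriv ?_
        rw [← laplace_X_mul, ← mul_assoc, ← pow_succ', ih (k + 1) (by omega) t, mul_zero, add_zero,
          sub_eq_zero]
        congr 2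
        ring
      intro t
      have hc := is_const_of_deriv_eq_zero (fun t => (hd t).differentiableAt)
        (fun t => (hd t).deriv) t 0
      simp only [shift_zero_left, rescale_zero, RingHom.comp_apply, constantCoeff_exp, map_one,
        one_mul, sub_self] at hc
      exact sub_eq_zero.mp hc
  ext m
  simpa using key m (m + 1) 0 (by omega) s

/-! ### The explicit sequence satisfies the recurrence -/

theorem derivative_rescale (r : ℝ) (f : ℝ⟦X⟧) :
    d⁄dX ℝ (rescale r f) = C r * rescale r (d⁄dX ℝ f) := by
  ext m
  simp only [coeff_derivative, coeff_rescale, coeff_C_mul]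
  ring

theorem derivative_expOf {f : ℝ⟦X⟧} (hf : constantCoeff f = 0) :
    d⁄dX ℝ (expOf f) = expOf f * d⁄dX ℝ f := by
  rw [expOf, derivative_subst (HasSubst.of_constantCoeff_zero' hf), derivative_exp]

theorem exp_ne_zero : PowerSeries.exp ℝ ≠ 0 := (isUnit_exp ℝ).ne_zero

theorem exp_mul_rescale_neg_one : PowerSeries.exp ℝ * rescale (-1) (PowerSeries.exp ℝ) = 1 :=
  exp_mul_exp_neg_eq_one

/-- The differential equation `(e^t + e^{-t} - 2) (1 + t² μ'(t)) = t²`. -/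
theorem derivative_mu_spec :
    (PowerSeries.exp ℝ + rescale (-1) (PowerSeries.exp ℝ) - 2) * (1 + X ^ 2 * d⁄dX ℝ mu) =
      X ^ 2 := by
  have h := mu_spec
  have h' := congrArg (d⁄dX ℝ) h
  have h1 := exp_mul_rescale_neg_one
  have hE := exp_ne_zero
  simp only [Derivation.leibniz, map_sub, derivative_exp, derivative_X, derivative_C,
    derivative_one, smul_eq_mul] at h'
  generalize PowerSeries.exp ℝ = E at *
  generalize rescale (-1) E = E' at *
  generalize (C (1 / 2) : ℝ⟦X⟧) = w at *
  generalize d⁄dX ℝ mu = ν at *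
  -- This combination of the equation for `μ` and its derivative eliminates `μ`, leaving only `μ'`.
  -- Since `E E' = 1`, one has `E (E + E' - 2) = (E - 1)²`.
  have h3 : (E - 1) ^ 2 + X ^ 2 * (E - 1) ^ 2 * ν = X ^ 2 * E := by
    linear_combination X * (E - 1) * h' - (E - 1 + X * E) * h
  apply mul_left_cancel₀ hE
  linear_combination (1 + X ^ 2 * ν) * h1 + h3

/-- The sign `(-1)^m` splits between the substitution `t ↦ -t` and the sign inside `besselCoeff`. -/
theorem mk_cDirect : mk cDirect = laplace (rescale (-1) (expOf mu)) := by
  ext m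
  rw [coeff_mk, coeff_laplace, cDirect, Finset.Nat.sum_antidiagonal_eq_sum_range_succ
    (f := fun i j => coeff i (rescale (-1) (expOf mu)) * besselCoeff i j),
    ← Finset.sum_range_reflect, Finset.mul_sum]
  refine Finset.sum_congr rfl fun j hj => ?_
  have hj : j ≤ m := by simpa [Nat.lt_succ_iff] using hj
  rw [show m + 1 - 1 - j = m - j by omega, show m - (m - j) = j by omega, coeff_rescale,
    besselCoeff, Nat.cast_sub hj, show (j : ℝ) - (m - j) + 3 / 2 = m - 2 * (m - j) + 3 / 2 by ring]
  have : ((-1 : ℝ)) ^ m = (-1) ^ j * (-1) ^ (m - j) := by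
    rw [← pow_add, Nat.add_sub_cancel' hj]
  rw [this]
  ring

theorem sum_shift_mk_cDirect :
    (1 + X ^ 2) * shift 1 (mk cDirect) + (1 - X ^ 2) * shift (-1) (mk cDirect) =
      (2 + X ^ 2) * mk cDirect := by
  rw [mk_cDirect, shift_laplace, shift_laplace]
  set G := rescale (-1) (expOf mu) with hG
  set E := PowerSeries.exp ℝ with hE
  have hr : rescale 1 E = E := by rw [rescale_one]; rfl
  rw [hr]
  set E' := rescale (-1) E with hE'
  have hrr : rescale (-1) E' = E := by
    rw [hE', rescale_rescale]; norm_num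
  set ν := rescale (-1) (d⁄dX ℝ mu) with hν
  have dG : d⁄dX ℝ G = -(G * ν) := by
    rw [hG, derivative_rescale, derivative_expOf constantCoeff_mu, map_mul, map_neg, map_one, neg_one_mul]
  have dE : d⁄dX ℝ E = E := derivative_exp ℝ
  have dE' : d⁄dX ℝ E' = -E' := by
    rw [hE', derivative_rescale, dE]
    simp
  have hQ : (E + E' - 2) * (1 + X ^ 2 * ν) = X ^ 2 := by
    have := congrArg (rescale (-1)) derivative_mu_spec
    simp only [map_mul, map_add, map_sub, map_one, map_pow, map_ofNat, rescale_neg_one_X,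
      neg_sq] at this
    rw [← hE, ← hE', hrr, ← hν] at this
    linear_combination this
  obtain ⟨q, hq⟩ : X ^ 2 ∣ E + E' - 2 := by
    rw [X_pow_dvd_iff]
    intro m hm
    rw [← map_ofNat (C (R := ℝ)) 2, map_sub, map_add, hE', coeff_rescale, coeff_C, hE]
    interval_cases m <;> simp [coeff_exp]
    norm_num
  -- The formal recurrence pulled back through the transform. As `G' = -G ν`, it reduces to `q (1 +
  -- t² ν) = 1`, which is `hQ` divided by `t²`.
  have h1 : q * G - d⁄dX ℝ (X ^ 2 * (q * G)) + (E - E' - 1) * G = 0 := by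
    rw [← mul_assoc, ← hq]
    have hX : (X ^ 2 : ℝ⟦X⟧) ≠ 0 := pow_ne_zero 2 X_ne_zero
    have h2 : d⁄dX ℝ (2 : ℝ⟦X⟧) = 0 := by
      rw [← map_ofNat (C (R := ℝ)) 2, derivative_C]
    simp only [Derivation.leibniz, map_sub, map_add, dE, dE', dG, h2, smul_eq_mul]
    apply mul_left_cancel₀ hX
    linear_combination G * hQ - G * hq
  have h3 := laplace_X_sq_mul (q * G)
  have h4 := congrArg laplace h1
  rw [← mul_assoc, ← hq] at h3
  rw [← mul_assoc, ← hq] at h4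
  simp only [map_add, map_sub, map_zero, sub_mul, add_mul, one_mul] at h3 h4 ⊢
  have h5 : laplace (2 * G) = 2 * laplace G := by rw [two_mul, map_add, two_mul]
  rw [h5] at h3
  linear_combination h3 + X ^ 2 * h4

/-- The coefficient `n + s` of the recurrence raises the exponent `-3/4 - j/2` by one, to `(1 -
2j)/4`. Indices `j ≥ m + 4` do not reach `h^{m+3}`. -/
theorem coeff_sum_symShift (c : ℕ → ℝ) (m : ℕ) :
    coeff (m + 3) (∑ j ∈ Finset.range (m + 4), C (c j) * X ^ j * symShift j) =
      coeff (m + 3) ((1 + X ^ 2) * shift 1 (mk c) + (1 - X ^ 2) * shift (-1) (mk c)) := by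
  have e : ∀ (s : ℝ) (j : ℕ), onePlusSq s ((1 - 2 * (j : ℝ)) / 4) * expOf (exponent s) * X ^ j =
      (1 + C s * X ^ 2) * shiftPow j s := by
    intro s j
    rw [shiftPow, ← onePlusSq_one,
      show (1 - 2 * (j : ℝ)) / 4 = 1 + (-3 / 4 - j / 2) by ring, ← onePlusSq_mul]
    ring
  have h : ∀ s : ℝ, coeff (m + 3) ((1 + C s * X ^ 2) * shift s (mk c)) =
      coeff (m + 3) ((1 + C s * X ^ 2) * ∑ j ∈ Finset.range (m + 4), C (c j) * shiftPow j s) := by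
    intro s
    have hk : ∀ k < m + 4, coeff k (shift s (mk c)) =
        coeff k (∑ j ∈ Finset.range (m + 4), C (c j) * shiftPow j s) := by
      intro k hk
      rw [coeff_shift hk, map_sum]
      simp
    simp only [add_mul, one_mul, map_add, mul_assoc, coeff_C_mul, show m + 3 = m + 1 + 2 by ring,
      coeff_X_pow_mul]
    rw [hk _ (by omega), hk _ (by omega)]
  have h1 := h 1
  have h2 := h (-1)
  simp only [map_neg, map_one, one_mul, neg_mul, ← sub_eq_add_neg] at h1 h2
  rw [map_add, h1, h2, ← map_add]
  congr 1
  rw [Finset.mul_sum, Finset.mul_sum, ← Finset.sum_add_distrib]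
  refine Finset.sum_congr rfl fun j _ => ?_
  have e1 := e 1 j
  have e2 := e (-1) j
  simp only [map_neg, map_one, one_mul, neg_mul, ← sub_eq_add_neg] at e1 e2
  rw [symShift, Finset.sum_pair (show (1 : ℝ) ≠ -1 by norm_num)]
  linear_combination C (c j) * (e1 + e2)

theorem cDirect_zero : cDirect 0 = 1 := by
  have := constantCoeff_expOf constantCoeff_mu
  simp [cDirect, this]

theorem cDirect_recurrence (m : ℕ) :
    (m : ℝ) * cDirect m =
      coeff (m + 3) (∑ j ∈ Finset.range m, C (cDirect j) * X ^ j * symShift j) :=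
  recurrence_of_coeff_eq (by rw [coeff_sum_symShift, sum_shift_mk_cDirect])

/-! ### Asymptotic expansions in powers of `n^{-1/2}` -/

/-- The asymptotic scale `n^{-1/2}`. -/
def scale (n : ℕ) : ℝ := (Real.sqrt n)⁻¹

theorem tendsto_scale : Filter.Tendsto scale Filter.atTop (nhds 0) :=
  (Real.tendsto_sqrt_atTop.comp tendsto_natCast_atTop_atTop).inv_tendsto_atTop

theorem scale_pos {n : ℕ} (h : 0 < n) : 0 < scale n := by
  have : (0 : ℝ) < n := by exact_mod_cast h
  exact inv_pos.mpr (Real.sqrt_pos.mpr this)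

theorem scale_sq (n : ℕ) : scale n ^ 2 = (n : ℝ)⁻¹ := by
  rw [scale, inv_pow, Real.sq_sqrt (Nat.cast_nonneg n)]

theorem isBigO_eval_scale (p : Polynomial ℝ) :
    (fun n => p.eval (scale n)) =O[Filter.atTop] (fun _ => (1 : ℝ)) :=
  ((p.continuous.tendsto 0).comp tendsto_scale).isBigO_one ℝ

theorem isBigO_scale_pow {i j : ℕ} (h : i ≤ j) :
    (fun n => scale n ^ j) =O[Filter.atTop] fun n => scale n ^ i := by
  obtain ⟨d, rfl⟩ := Nat.exists_eq_add_of_le h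
  have := (Asymptotics.isBigO_refl (fun n => scale n ^ i) Filter.atTop).mul
    (isBigO_eval_scale (Polynomial.X ^ d))
  simpa [pow_add] using this

/-- `F n` equals the truncation of `f` at order `M`, evaluated at `n^{-1/2}`, up to `O(n^{-M/2})`. -/
def AsymTo (M : ℕ) (F : ℕ → ℝ) (f : ℝ⟦X⟧) : Prop :=
  (fun n => F n - ∑ k ∈ Finset.range M, coeff k f * scale n ^ k)
    =O[Filter.atTop] fun n => scale n ^ M

theorem eval_trunc (M : ℕ) (f : ℝ⟦X⟧) (x : ℝ) :
    (trunc M f).eval x = ∑ k ∈ Finset.range M, coeff k f * x ^ k := by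
  simpa using eval₂_trunc_eq_sum_range x (RingHom.id ℝ) M f

theorem asymTo_iff {M : ℕ} {F : ℕ → ℝ} {f : ℝ⟦X⟧} :
    AsymTo M F f ↔ (fun n => F n - (trunc M f).eval (scale n))
      =O[Filter.atTop] fun n => scale n ^ M := by
  simp only [AsymTo, eval_trunc]

theorem asymTo_eval (M : ℕ) (p : Polynomial ℝ) :
    AsymTo M (fun n => p.eval (scale n)) (p : ℝ⟦X⟧) := by
  rw [asymTo_iff]
  obtain ⟨q, hq⟩ : Polynomial.X ^ M ∣ p - trunc M (p : ℝ⟦X⟧) := by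
    rw [Polynomial.X_pow_dvd_iff]
    intro d hd
    rw [Polynomial.coeff_sub, coeff_trunc, if_pos hd, Polynomial.coeff_coe, sub_self]
  simp only [← Polynomial.eval_sub, hq, Polynomial.eval_mul, Polynomial.eval_pow,
    Polynomial.eval_X]
  simpa using (Asymptotics.isBigO_refl (fun n => scale n ^ M) Filter.atTop).mul
    (isBigO_eval_scale q)

namespace AsymTo

variable {M : ℕ} {F G : ℕ → ℝ} {f g : ℝ⟦X⟧}

theorem congr_coeff (hF : AsymTo M F f) (h : ∀ k < M, coeff k f = coeff k g) : AsymTo M F g := by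
  have : ∀ n, ∑ k ∈ Finset.range M, coeff k g * scale n ^ k =
      ∑ k ∈ Finset.range M, coeff k f * scale n ^ k := fun n =>
    Finset.sum_congr rfl fun k hk => by rw [h k (Finset.mem_range.mp hk)]
  simpa only [AsymTo, this] using hF

theorem congr' (hF : AsymTo M F f) (h : F =ᶠ[Filter.atTop] G) : AsymTo M G f :=
  Asymptotics.IsBigO.congr' hF (h.mono fun n hn => by simp only [hn]) Filter.EventuallyEq.rfl

theorem of_isBigO_sub (hF : AsymTo M F f)
    (h : (fun n => G n - F n) =O[Filter.atTop] fun n => scale n ^ M) : AsymTo M G f := by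
  refine (h.add hF).congr_left fun n => ?_
  ring

theorem add (hF : AsymTo M F f) (hG : AsymTo M G g) : AsymTo M (fun n => F n + G n) (f + g) := by
  refine (Asymptotics.IsBigO.add hF hG).congr_left fun n => ?_
  simp only [map_add, add_mul, Finset.sum_add_distrib]
  ring

theorem neg (hF : AsymTo M F f) : AsymTo M (fun n => -F n) (-f) := by
  refine (Asymptotics.IsBigO.neg_left hF).congr_left fun n => ?_
  simp only [map_neg, neg_mul, Finset.sum_neg_distrib]
  ring

theorem sub (hF : AsymTo M F f) (hG : AsymTo M G g) : AsymTo M (fun n => F n - G n) (f - g) := by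
  simpa only [sub_eq_add_neg] using hF.add hG.neg

theorem isBigO_one (hF : AsymTo M F f) : F =O[Filter.atTop] (fun _ => (1 : ℝ)) := by
  rw [asymTo_iff] at hF
  have h0 := isBigO_scale_pow (Nat.zero_le M)
  simp only [pow_zero] at h0
  have h := hF.trans h0
  exact (h.add (isBigO_eval_scale (trunc M f))).congr_left fun n => by ring

theorem const (M : ℕ) (r : ℝ) : AsymTo M (fun _ => r) (C r) := by
  simpa using asymTo_eval M (Polynomial.C r)

theorem scale_pow (M j : ℕ) : AsymTo M (fun n => scale n ^ j) (X ^ j) := by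
  simpa using asymTo_eval M (Polynomial.X ^ j)

theorem mul (hF : AsymTo M F f) (hG : AsymTo M G g) : AsymTo M (fun n => F n * G n) (f * g) := by
  have h := asymTo_eval M (trunc M f * trunc M g)
  have h1 : AsymTo M (fun n => (trunc M f * trunc M g).eval (scale n)) (f * g) := by
    refine h.congr_coeff fun k hk => ?_
    rw [coeff_mul_eq_coeff_trunc_mul_trunc f g hk, Polynomial.coe_mul]
  refine h1.of_isBigO_sub ?_
  have h2 := hF.isBigO_one.mul (asymTo_iff.mp hG)
  have h3 := (asymTo_iff.mp hF).mul (isBigO_eval_scale (trunc M g))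
  simp only [one_mul, mul_one] at h2 h3
  refine (h2.add h3).congr_left fun n => ?_
  rw [Polynomial.eval_mul]
  ring

theorem pow (hF : AsymTo M F f) (k : ℕ) : AsymTo M (fun n => F n ^ k) (f ^ k) := by
  induction k with
  | zero => simpa using const M 1
  | succ k ih => simpa only [pow_succ] using ih.mul hF

theorem sum {ι : Type*} (s : Finset ι) {F : ι → ℕ → ℝ} {f : ι → ℝ⟦X⟧}
    (h : ∀ i ∈ s, AsymTo M (F i) (f i)) :
    AsymTo M (fun n => ∑ i ∈ s, F i n) (∑ i ∈ s, f i) := by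
  classical
  induction s using Finset.induction_on with
  | empty => simpa using const M 0
  | insert i s hi ih =>
    simp only [Finset.sum_insert hi]
    exact (h i (Finset.mem_insert_self i s)).add
      (ih fun j hj => h j (Finset.mem_insert_of_mem hj))

theorem mono {N : ℕ} (hF : AsymTo M F f) (h : N ≤ M) : AsymTo N F f := by
  have h1 := (asymTo_eval N (trunc M f)).congr_coeff (g := f) fun k hk => by
    rw [Polynomial.coeff_coe, coeff_trunc, if_pos (by omega)]
  exact h1.of_isBigO_sub ((asymTo_iff.mp hF).trans (isBigO_scale_pow h))

/-- Uniqueness of expansions: once the lower coefficients vanish, dividing by `scale n ^ k` shows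
the constant `coeff k f` to be `O(n^{-1/2})`. -/
theorem coeff_eq_zero (h : AsymTo M (fun _ => 0) f) : ∀ k < M, coeff k f = 0 := by
  intro k
  induction k using Nat.strong_induction_on with
  | _ k ih =>
    intro hk
    have h1 : AsymTo (k + 1) (fun _ => 0) f := h.mono hk
    rw [AsymTo] at h1
    have h2 : (fun n => scale n ^ k * coeff k f) =O[Filter.atTop]
        fun n => scale n ^ k * scale n := by
      refine h1.neg_left.congr (fun n => ?_) fun n => pow_succ _ _
      rw [Finset.sum_range_succ, Finset.sum_eq_zero]
      · ring
      · intro j hj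
        have := Finset.mem_range.mp hj
        rw [ih j this (by omega), zero_mul]
    have h3 : (fun _ : ℕ => coeff k f) =O[Filter.atTop] scale := by
      obtain ⟨K, hK⟩ := h2.bound
      refine Asymptotics.IsBigO.of_bound K ?_
      filter_upwards [hK, Filter.eventually_gt_atTop 0] with n hn h0
      have hp : 0 < ‖scale n ^ k‖ := norm_pos_iff.mpr (pow_pos (scale_pos h0) k).ne'
      rw [norm_mul, norm_mul, mul_left_comm] at hn
      exact le_of_mul_le_mul_left hn hp
    exact tendsto_nhds_unique tendsto_const_nhds (h3.trans_tendsto tendsto_scale)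

theorem coeff_eq (hf : AsymTo M F f) (hg : AsymTo M F g) {k : ℕ} (hk : k < M) :
    coeff k f = coeff k g := by
  have h := hf.sub hg
  simp only [sub_self] at h
  simpa [sub_eq_zero] using h.coeff_eq_zero k hk

theorem div_scale (hF : AsymTo (M + 1) F f) (h0 : coeff 0 f = 0) :
    AsymTo M (fun n => F n / scale n) (divX f) := by
  rw [AsymTo] at hF ⊢
  have h := hF.mul (Asymptotics.isBigO_refl (fun n => (scale n)⁻¹) Filter.atTop)
  refine h.congr' ?_ ?_
  · filter_upwards [Filter.eventually_gt_atTop 0] with n hn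
    have hs := (scale_pos hn).ne'
    rw [Finset.sum_range_succ', h0, zero_mul, add_zero, sub_mul, Finset.sum_mul, div_eq_mul_inv]
    congr 1
    refine Finset.sum_congr rfl fun k _ => ?_
    rw [divX, coeff_mk, pow_succ]
    field_simp
  · filter_upwards [Filter.eventually_gt_atTop 0] with n hn
    rw [pow_succ, mul_inv_cancel_right₀ (scale_pos hn).ne']

/-- Without constant term `F = O(n^{-1/2})`, so the Taylor remainder of order `M` is `O(n^{-M/2})`.
-/
theorem exp (hF : AsymTo M F f) (h0 : constantCoeff f = 0) (hM : 0 < M) :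
    AsymTo M (fun n => Real.exp (F n)) (expOf f) := by
  have h1 : F =O[Filter.atTop] scale := by
    have := hF.mono (show 1 ≤ M from hM)
    rw [AsymTo] at this
    simpa [h0] using this
  have h2 := (Real.exp_sub_sum_range_isBigO_pow M).comp_tendsto (h1.trans_tendsto tendsto_scale)
  have h3 : AsymTo M (fun n => ∑ k ∈ Finset.range M, ((k.factorial : ℝ))⁻¹ * F n ^ k)
      (∑ k ∈ Finset.range M, C ((k.factorial : ℝ))⁻¹ * f ^ k) :=
    AsymTo.sum _ fun k _ => (const M _).mul (hF.pow k)
  refine (h3.congr_coeff fun k hk => ?_).of_isBigO_sub ?_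
  · simp only [map_sum, coeff_C_mul]
    exact (coeff_expOf h0 hk).symm
  · refine (h2.trans (h1.pow M)).congr_left fun n => ?_
    simp only [Function.comp]
    congr 1
    exact Finset.sum_congr rfl fun k _ => by ring

end AsymTo

theorem asymTo_onePlusSq (M : ℕ) (s α : ℝ) :
    AsymTo M (fun n => (1 + s * scale n ^ 2) ^ α) (onePlusSq s α) := by
  have ht : Filter.Tendsto (fun n => s * scale n ^ 2) Filter.atTop (nhds 0) := by
    simpa using (tendsto_scale.pow 2).const_mul s
  have h1 := ((Real.one_add_rpow_hasFPowerSeriesAt_zero (a := α)).isBigO_sub_partialSum_pow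
    M).comp_tendsto ht
  have h2 := asymTo_eval M
    (∑ k ∈ Finset.range M, Polynomial.C (Ring.choose α k * s ^ k) * Polynomial.X ^ (2 * k))
  refine (h2.congr_coeff fun k hk => ?_).of_isBigO_sub ?_
  · rw [Polynomial.coeff_coe, Polynomial.finsetSum_coeff, coeff_onePlusSq]
    simp only [Polynomial.coeff_C_mul, Polynomial.coeff_X_pow, mul_ite, mul_one, mul_zero]
    split_ifs with he
    · obtain ⟨r, rfl⟩ := he
      rw [Finset.sum_eq_single r]
      · rw [if_pos (by ring), show (r + r) / 2 = r by omega]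
      · intro j _ hj
        rw [if_neg (by omega)]
      · intro hr
        exact absurd (Finset.mem_range.mpr (by omega)) hr
    · refine Finset.sum_eq_zero fun j _ => ?_
      rw [if_neg (by rintro rfl; exact he (even_two_mul j))]
  · have h3 : (fun n => ‖s * scale n ^ 2‖ ^ M) =O[Filter.atTop] fun n => scale n ^ M := by
      have : (fun n => s * scale n ^ 2) =O[Filter.atTop] scale := by
        simpa using (isBigO_scale_pow (show 1 ≤ 2 by norm_num)).const_mul_left s
      exact this.norm_left.pow M
    refine (h1.trans h3).congr_left fun n => ?_
    simp only [Function.comp, zero_add, FormalMultilinearSeries.partialSum, binomialSeries_apply,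
      Polynomial.eval_finsetSum]
    congr 1
    refine Finset.sum_congr rfl fun k _ => ?_
    simp [mul_pow, ← pow_mul, mul_assoc]

theorem asymTo_sqrt_sub (M : ℕ) (s : ℝ) :
    AsymTo M (fun n => 2 * Real.sqrt (n + s) - 2 * Real.sqrt n) (exponent s) := by
  -- Order `M + 1`, because the division by `h` costs one order.
  have h := (asymTo_onePlusSq (M + 1) s (1 / 2)).sub (AsymTo.const (M + 1) 1)
  have h1 := (AsymTo.const M 2).mul (h.div_scale (by simp [constantCoeff_onePlusSq]))
  rw [map_one] at h1
  refine h1.congr' ?_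
  filter_upwards [Filter.eventually_gt_atTop 0] with n hn
  have hn' : (0 : ℝ) < n := by exact_mod_cast hn
  have hs : 0 < Real.sqrt n := Real.sqrt_pos.mpr hn'
  rw [← Real.sqrt_eq_rpow, scale_sq, scale,
    show (n : ℝ) + s = n * (1 + s * (n : ℝ)⁻¹) by field_simp, Real.sqrt_mul hn'.le]
  field_simp

/-- Substituting `n + s` for `n` in an asymptotic expansion. -/
theorem AsymTo.comp_shift {M : ℕ} {u : ℕ → ℝ} {c : ℕ → ℝ} {s : ℝ} {σ : ℕ → ℕ}
    (hu : AsymTo M u (mk c)) (hσ : ∀ᶠ n in Filter.atTop, (σ n : ℝ) = n + s) :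
    AsymTo M (fun n => u (σ n))
      (∑ k ∈ Finset.range M, C (c k) * (X ^ k * onePlusSq s (-k / 2))) := by
  have hσt : Filter.Tendsto σ Filter.atTop Filter.atTop := by
    rw [← tendsto_natCast_atTop_iff (R := ℝ)]
    refine Filter.Tendsto.congr' (hσ.mono fun n hn => hn.symm) ?_
    exact Filter.tendsto_atTop_add_const_right _ _ tendsto_natCast_atTop_atTop
  have hpos : ∀ᶠ n : ℕ in Filter.atTop, 0 < 1 + s * scale n ^ 2 := by
    have : Filter.Tendsto (fun n => 1 + s * scale n ^ 2) Filter.atTop (nhds 1) := by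
      simpa using ((tendsto_scale.pow 2).const_mul s).const_add 1
    exact this.eventually (lt_mem_nhds one_pos)
  have hsc : ∀ᶠ n : ℕ in Filter.atTop, ∀ k : ℕ,
      scale (σ n) ^ k = scale n ^ k * (1 + s * scale n ^ 2) ^ (-(k : ℝ) / 2) := by
    filter_upwards [hσ, hpos, Filter.eventually_gt_atTop 0] with n h1 h2 h3 k
    have hn' : (0 : ℝ) < n := by exact_mod_cast h3
    have e1 : scale (σ n) = scale n * (1 + s * scale n ^ 2) ^ (-(1 / 2) : ℝ) := by
      rw [Real.rpow_neg h2.le, ← Real.sqrt_eq_rpow, scale, scale, ← mul_inv,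
        ← Real.sqrt_mul hn'.le, h1]
      congr 2
      change _ = _ * (1 + s * scale n ^ 2)
      rw [scale_sq]
      field_simp
    rw [e1, mul_pow, ← Real.rpow_mul_natCast h2.le]
    congr 2
    ring
  have h1 : AsymTo M (fun n => ∑ k ∈ Finset.range M,
      c k * (scale n ^ k * (1 + s * scale n ^ 2) ^ (-(k : ℝ) / 2)))
      (∑ k ∈ Finset.range M, C (c k) * (X ^ k * onePlusSq s (-k / 2))) :=
    AsymTo.sum _ fun k _ => (AsymTo.const M _).mul
      ((AsymTo.scale_pow M k).mul (asymTo_onePlusSq M s _))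
  refine h1.of_isBigO_sub ?_
  rw [AsymTo] at hu
  have h2 := hu.comp_tendsto hσt
  have h3 : (fun n => scale (σ n) ^ M) =O[Filter.atTop] fun n => scale n ^ M := by
    have := (Asymptotics.isBigO_refl (fun n => scale n ^ M) Filter.atTop).mul
      (asymTo_onePlusSq 0 s (-(M : ℝ) / 2)).isBigO_one
    simp only [mul_one] at this
    exact this.congr' (hsc.mono fun n hn => (hn M).symm) Filter.EventuallyEq.rfl
  refine (h2.trans h3).congr' (hsc.mono fun n hn => ?_) Filter.EventuallyEq.rfl
  simp only [Function.comp, coeff_mk, hn]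

theorem HasPoincareExpansion.asymTo {u g : ℕ → ℝ} {e : ℕ → ℝ} (h : HasPoincareExpansion u g e)
    {M : ℕ} (hM : 0 < M) : AsymTo M (fun n => u n / g n) (mk e) := by
  simpa only [AsymTo, coeff_mk, scale] using h M hM

/-! ### The three-term recurrences -/

theorem hasDerivAt_E1 {x : ℝ} (hx : 0 < x) : HasDerivAt E1 (-(Real.exp (-x) / x)) x := by
  -- Basing the integral at `x / 2` stays away from the singularity at 0 and leaves room around `x`
  -- for the fundamental theorem of calculus.
  have hy : 0 < x / 2 := by positivity
  have hc : ContinuousOn (fun t : ℝ => Real.exp (-t) / t) (Set.Ioi 0) :=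
    (Real.continuous_exp.comp continuous_neg).continuousOn.div continuousOn_id
      fun t ht => (Set.mem_Ioi.mp ht).ne'
  have hint : MeasureTheory.IntegrableOn (fun t : ℝ => Real.exp (-t) / t) (Set.Ioi (x / 2)) := by
    refine MeasureTheory.Integrable.mono' ((integrableOn_exp_neg_Ioi (x / 2)).div_const (x / 2))
      ((hc.mono (Set.Ioi_subset_Ioi hy.le)).aestronglyMeasurable measurableSet_Ioi) ?_
    filter_upwards [MeasureTheory.ae_restrict_mem measurableSet_Ioi] with t ht
    have ht' : x / 2 < t := ht
    rw [Real.norm_of_nonneg (div_nonneg (Real.exp_nonneg _) (hy.trans ht').le)]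
    gcongr
  have hev : E1 =ᶠ[nhds x] fun y =>
      (∫ t in Set.Ioi (x / 2), Real.exp (-t) / t) - ∫ t in (x / 2)..y, Real.exp (-t) / t := by
    filter_upwards [lt_mem_nhds (show x / 2 < x by linarith)] with y hy'
    rw [← intervalIntegral.integral_Ioi_sub_Ioi hint (le_of_lt hy'), E1]
    ring
  have hd : HasDerivAt (fun y => ∫ t in (x / 2)..y, Real.exp (-t) / t) (Real.exp (-x) / x) x := by
    refine intervalIntegral.integral_hasDerivAt_right ?_ ?_ ?_
    · refine (hc.mono fun t ht => ?_).intervalIntegrable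
      rw [Set.uIcc_of_le (by linarith)] at ht
      exact hy.trans_le ht.1
    · exact hc.stronglyMeasurableAtFilter isOpen_Ioi x hx
    · exact hc.continuousAt (Ioi_mem_nhds hx)
  exact (hd.const_sub _).congr_of_eventuallyEq hev

theorem contDiffOn_E1 : ContDiffOn ℝ (⊤ : ℕ∞) E1 (Set.Ioi 0) := by
  rw [contDiffOn_infty_iff_deriv_of_isOpen isOpen_Ioi]
  refine ⟨fun x hx => (hasDerivAt_E1 hx).differentiableAt.differentiableWithinAt, ?_⟩
  have : ContDiffOn ℝ (⊤ : ℕ∞) (fun x : ℝ => -(Real.exp (-x) / x)) (Set.Ioi 0) :=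
    ((Real.contDiff_exp.comp contDiff_neg).contDiffOn.div contDiffOn_id
      fun x hx => (Set.mem_Ioi.mp hx).ne').neg
  exact this.congr fun x hx => (hasDerivAt_E1 hx).deriv

theorem contDiffOn_one_sub : ContDiffOn ℝ (⊤ : ℕ∞) (fun z : ℝ => 1 - z) (Set.Iio 1) :=
  (contDiff_const.sub contDiff_id).contDiffOn

theorem one_sub_ne_zero {z : ℝ} (hz : z ∈ Set.Iio (1 : ℝ)) : 1 - z ≠ 0 :=
  (sub_pos.mpr hz).ne'

theorem contDiffOn_f0 : ContDiffOn ℝ (⊤ : ℕ∞) f0 (Set.Iio 1) :=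
  Real.contDiff_exp.comp_contDiffOn
    (contDiffOn_id.div contDiffOn_one_sub fun _ hz => one_sub_ne_zero hz)

theorem contDiffOn_f1 : ContDiffOn ℝ (⊤ : ℕ∞) f1 (Set.Iio 1) := by
  have h : ContDiffOn ℝ (⊤ : ℕ∞) (fun z : ℝ => 1 / (1 - z)) (Set.Iio 1) :=
    contDiffOn_const.div contDiffOn_one_sub fun _ hz => one_sub_ne_zero hz
  exact (Real.contDiff_exp.comp_contDiffOn h).mul
    (contDiffOn_E1.comp h fun z hz => Set.mem_Ioi.mpr (one_div_pos.mpr (sub_pos.mpr hz)))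

theorem hasDerivAt_f0 {z : ℝ} (hz : z < 1) : HasDerivAt f0 (f0 z / (1 - z) ^ 2) z := by
  have hz' : 1 - z ≠ 0 := one_sub_ne_zero hz
  have h := ((hasDerivAt_id z).div ((hasDerivAt_id z).const_sub 1) hz').exp
  refine h.congr_deriv ?_
  simp only [id, f0, Pi.div_apply]
  field_simp
  ring

theorem hasDerivAt_f1 {z : ℝ} (hz : z < 1) :
    HasDerivAt f1 (f1 z / (1 - z) ^ 2 - 1 / (1 - z)) z := by
  have hz' : 1 - z ≠ 0 := one_sub_ne_zero hz
  have h := (hasDerivAt_const z (1 : ℝ)).div ((hasDerivAt_id z).const_sub 1) hz'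
  have hE := (hasDerivAt_E1 (one_div_pos.mpr (sub_pos.mpr hz))).comp z h
  refine (h.exp.mul hE).congr_deriv ?_
  have he : Real.exp (1 / (1 - z)) * Real.exp (-(1 / (1 - z))) = 1 := by
    rw [← Real.exp_add, add_neg_cancel, Real.exp_zero]
  simp only [id, f1, Pi.div_apply, Function.comp]
  field_simp at he ⊢
  linear_combination (-(1 - z)) * he

theorem hasDerivAt_iteratedDeriv {f : ℝ → ℝ} (hf : ContDiffOn ℝ (⊤ : ℕ∞) f (Set.Iio 1)) (n : ℕ)
    {z : ℝ} (hz : z < 1) : HasDerivAt (iteratedDeriv n f) (iteratedDeriv (n + 1) f z) z := by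
  rw [iteratedDeriv_succ]
  refine DifferentiableAt.hasDerivAt ?_
  have h1 := hf.differentiableOn_iteratedDerivWithin (m := n) (by exact_mod_cast ENat.natCast_lt_top n)
    (uniqueDiffOn_Iio 1)
  have h2 := (h1 z hz).differentiableAt (Iio_mem_nhds hz)
  refine h2.congr_of_eventuallyEq ?_
  filter_upwards [Iio_mem_nhds hz] with y hy
  exact (iteratedDerivWithin_of_isOpen isOpen_Iio hy).symm

theorem deriv_unique_of_eqOn {A B : ℝ → ℝ} {A' B' z : ℝ} (hz : z < 1)
    (h : ∀ y < 1, A y = B y) (hA : HasDerivAt A A' z) (hB : HasDerivAt B B' z) : A' = B' := by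
  refine hA.unique (hB.congr_of_eventuallyEq ?_)
  filter_upwards [Iio_mem_nhds hz] with y hy
  exact h y hy

/-- One differentiation of the equation sends `(α, β)` to `(α + 2, β + α)`, a step that preserves
the pattern `α = 2(n+1)`, `β = n(n+1)`. -/
theorem ode_step {f p : ℝ → ℝ} (hf : ContDiffOn ℝ (⊤ : ℕ∞) f (Set.Iio 1)) {α β p' z : ℝ} {n : ℕ}
    (h : ∀ z < 1, (1 - z) ^ 2 * iteratedDeriv (n + 2) f z -
      α * ((1 - z) * iteratedDeriv (n + 1) f z) + β * iteratedDeriv n f z =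
        iteratedDeriv (n + 1) f z + p z)
    (hz : z < 1) (hp : HasDerivAt p p' z) :
    (1 - z) ^ 2 * iteratedDeriv (n + 3) f z -
      (α + 2) * ((1 - z) * iteratedDeriv (n + 2) f z) + (β + α) * iteratedDeriv (n + 1) f z =
        iteratedDeriv (n + 2) f z + p' := by
  have hl : HasDerivAt (fun z : ℝ => 1 - z) (-1) z := (hasDerivAt_id z).const_sub 1
  have hD := fun n => hasDerivAt_iteratedDeriv hf n hz
  have := deriv_unique_of_eqOn hz h
    ((((hl.fun_pow 2).mul (hD (n + 2))).sub ((hl.mul (hD (n + 1))).const_mul α)).add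
      ((hD n).const_mul β)) ((hD (n + 1)).add hp)
  norm_num at this
  linear_combination this

theorem ode_iterate {f : ℝ → ℝ} (hf : ContDiffOn ℝ (⊤ : ℕ∞) f (Set.Iio 1)) {N : ℕ}
    (h : ∀ z < 1, (1 - z) ^ 2 * iteratedDeriv (N + 2) f z -
      (2 * (N + 1)) * ((1 - z) * iteratedDeriv (N + 1) f z) +
        ((N + 1) * N) * iteratedDeriv N f z = iteratedDeriv (N + 1) f z) {n : ℕ} (hn : N ≤ n) :
    ∀ z < 1, (1 - z) ^ 2 * iteratedDeriv (n + 2) f z -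
      (2 * (n + 1)) * ((1 - z) * iteratedDeriv (n + 1) f z) +
        ((n + 1) * n) * iteratedDeriv n f z = iteratedDeriv (n + 1) f z := by
  induction n, hn using Nat.le_induction with
  | base => exact h
  | succ n hn ih =>
    intro z hz
    have := ode_step (p := fun _ => 0) hf (fun z hz => by simpa using ih z hz) hz
      (hasDerivAt_const z 0)
    push_cast
    linear_combination this

theorem maclaurin_recurrence {f : ℝ → ℝ} {n : ℕ}
    (h : (1 - 0 : ℝ) ^ 2 * iteratedDeriv (n + 2) f 0 -
      (2 * (n + 1)) * ((1 - 0) * iteratedDeriv (n + 1) f 0) +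
        ((n + 1) * n) * iteratedDeriv n f 0 = iteratedDeriv (n + 1) f 0) :
    (n + 2 : ℝ) * maclaurin f (n + 2) + n * maclaurin f n =
      (2 * n + 3) * maclaurin f (n + 1) := by
  simp only [maclaurin, Nat.factorial_succ]
  have : (n.factorial : ℝ) ≠ 0 := by positivity
  have h1 : (n + 1 : ℝ) ≠ 0 := by positivity
  have h2 : (n + 1 + 1 : ℝ) ≠ 0 := by positivity
  push_cast
  field_simp
  linear_combination h * (n + 2 : ℝ)

theorem f0_ode {z : ℝ} (hz : z < 1) : (1 - z) ^ 2 * iteratedDeriv 1 f0 z = iteratedDeriv 0 f0 z := by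
  have hz' : 1 - z ≠ 0 := one_sub_ne_zero hz
  rw [iteratedDeriv_one, iteratedDeriv_zero, (hasDerivAt_f0 hz).deriv]
  field_simp

theorem f0_ode_one {z : ℝ} (hz : z < 1) : (1 - z) ^ 2 * iteratedDeriv 2 f0 z -
    2 * ((1 - z) * iteratedDeriv 1 f0 z) = iteratedDeriv 1 f0 z := by
  have hl : HasDerivAt (fun z : ℝ => 1 - z) (-1) z := (hasDerivAt_id z).const_sub 1
  have hD := fun n => hasDerivAt_iteratedDeriv contDiffOn_f0 n hz
  have := deriv_unique_of_eqOn hz (fun y hy => f0_ode hy) ((hl.fun_pow 2).mul (hD 1)) (hD 0)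
  norm_num at this ⊢
  linear_combination this

theorem a_recurrence (n : ℕ) : (n + 2 : ℝ) * a (n + 2) + n * a n = (2 * n + 3) * a (n + 1) :=
  maclaurin_recurrence (ode_iterate contDiffOn_f0 (N := 0)
    (fun z hz => by simpa using f0_ode_one hz) (Nat.zero_le n) 0 zero_lt_one)

theorem f1_ode {z : ℝ} (hz : z < 1) :
    (1 - z) ^ 2 * iteratedDeriv 1 f1 z = iteratedDeriv 0 f1 z - (1 - z) := by
  have hz' : 1 - z ≠ 0 := one_sub_ne_zero hz
  rw [iteratedDeriv_one, iteratedDeriv_zero, (hasDerivAt_f1 hz).deriv]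
  field_simp

theorem f1_ode_one {z : ℝ} (hz : z < 1) : (1 - z) ^ 2 * iteratedDeriv 2 f1 z -
    2 * ((1 - z) * iteratedDeriv 1 f1 z) = iteratedDeriv 1 f1 z + 1 := by
  have hl : HasDerivAt (fun z : ℝ => 1 - z) (-1) z := (hasDerivAt_id z).const_sub 1
  have hD := fun n => hasDerivAt_iteratedDeriv contDiffOn_f1 n hz
  have := deriv_unique_of_eqOn hz (fun y hy => f1_ode hy) ((hl.fun_pow 2).mul (hD 1))
    ((hD 0).sub hl)
  norm_num at this ⊢
  linear_combination this

/-- The inhomogeneous term `-(1 - z)` of the equation for `f1` disappears only after two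
differentiations, hence the start at `n = 1`. -/
theorem b_recurrence {n : ℕ} (hn : 1 ≤ n) :
    (n + 2 : ℝ) * b (n + 2) + n * b n = (2 * n + 3) * b (n + 1) := by
  refine maclaurin_recurrence (ode_iterate contDiffOn_f1 (N := 1) (fun z hz => ?_) hn 0 zero_lt_one)
  have := ode_step (n := 0) (α := 2) (β := 0) (p := fun _ => 1) contDiffOn_f1
    (fun z hz => by simpa using f1_ode_one hz) hz (hasDerivAt_const z 1)
  norm_num at this ⊢
  exact this

theorem a_zero : a 0 = 1 := by simp [a, maclaurin, f0]

theorem a_one : a 1 = 1 := by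
  have := f0_ode zero_lt_one
  have h0 := a_zero
  simp [a, maclaurin] at this h0 ⊢
  rw [this, h0]

/-- The increments `d_n = (n+1) a_{n+1} - n a_n` satisfy `d_{n+1} = d_n + a_{n+1}`, so nonnegativity
propagates. -/
theorem a_nonneg (n : ℕ) : 0 ≤ a n := by
  have h : ∀ n : ℕ, 0 ≤ a n ∧ 0 ≤ a (n + 1) ∧ 0 ≤ (n + 1 : ℝ) * a (n + 1) - n * a n := by
    intro n
    induction n with
    | zero => simp [a_zero, a_one]
    | succ n ih =>
      obtain ⟨h1, h2, h3⟩ := ih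
      have hr := a_recurrence n
      have h4 : 0 ≤ (n + 2 : ℝ) * a (n + 2) - (n + 1) * a (n + 1) := by linarith
      have h5 : 0 ≤ (n + 1 : ℝ) * a (n + 1) := by positivity
      refine ⟨h2, ?_, ?_⟩
      · have h6 : 0 ≤ (n + 2 : ℝ) * a (n + 2) := by linarith
        exact nonneg_of_mul_nonneg_right h6 (by positivity)
      · push_cast
        rw [show n + 1 + 1 = n + 2 by ring, show (n + 1 + 1 : ℝ) = n + 2 by ring]
        exact h4
  exact (h n).1

/-- The Casoratian of the two solutions. -/
theorem casoratian {n : ℕ} (hn : 1 ≤ n) :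
    (n : ℝ) * (n + 1) * (a n * b (n + 1) - a (n + 1) * b n) = 1 := by
  induction n, hn using Nat.le_induction with
  | base =>
    have ha := a_recurrence 0
    -- At `z = 0` this reads `2 b_2 = 3 b_1 + 1`; its inhomogeneous 1 is the value of the
    -- Casoratian.
    have hb := f1_ode_one zero_lt_one
    have hb1 : b 1 = iteratedDeriv 1 f1 0 := by simp [b, maclaurin]
    have hb2 : b 2 = iteratedDeriv 2 f1 0 / 2 := by simp [b, maclaurin]
    norm_num [a_one] at ha hb ⊢
    rw [hb1, hb2]
    simp only [iteratedDeriv_one]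
    linear_combination hb - deriv f1 0 * ha
  | succ n hn ih =>
    have ha := a_recurrence n
    have hb := b_recurrence hn
    push_cast
    rw [show n + 1 + 1 = n + 2 by ring]
    linear_combination ih + (n + 1 : ℝ) * (a (n + 1) * hb - b (n + 1) * ha)

/-! ### Coefficients of Poincaré expansions of the two solutions -/

/-- The leading behaviour of `a_n`. -/
def amplitude (x : ℝ) : ℝ :=
  Real.exp (2 * Real.sqrt x) / (2 * x ^ (3 / 4 : ℝ) * Real.sqrt (Real.pi * Real.exp 1))

theorem amplitude_pos {x : ℝ} (hx : 0 < x) : 0 < amplitude x := by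
  have := Real.pi_pos
  unfold amplitude
  positivity

theorem amplitude_shift {n : ℕ} {s : ℝ} (hn : 0 < n) (hs : 0 < (n : ℝ) + s) :
    (n + s) * amplitude (n + s) = n * amplitude n *
      ((1 + s * scale n ^ 2) ^ (1 / 4 : ℝ) * Real.exp (2 * Real.sqrt (n + s) - 2 * Real.sqrt n)) := by
  have hn' : (0 : ℝ) < n := by exact_mod_cast hn
  have e : (n : ℝ) + s = n * (1 + s * scale n ^ 2) := by
    rw [scale_sq]; field_simp
  have hw : 0 < 1 + s * scale n ^ 2 := by
    rw [e] at hs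
    exact pos_of_mul_pos_right hs hn'.le
  have e1 : (1 + s * scale n ^ 2) =
      (1 + s * scale n ^ 2) ^ (1 / 4 : ℝ) * (1 + s * scale n ^ 2) ^ (3 / 4 : ℝ) := by
    rw [← Real.rpow_add hw]; norm_num
  have e2 : ((n : ℝ) + s) ^ (3 / 4 : ℝ) =
      (n : ℝ) ^ (3 / 4 : ℝ) * (1 + s * scale n ^ 2) ^ (3 / 4 : ℝ) := by
    rw [e, Real.mul_rpow hn'.le hw.le]
  have e3 : (n : ℝ) + s = n * ((1 + s * scale n ^ 2) ^ (1 / 4 : ℝ) *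
      (1 + s * scale n ^ 2) ^ (3 / 4 : ℝ)) := by rw [← e1, e]
  have h1 : 0 < (1 + s * scale n ^ 2) ^ (3 / 4 : ℝ) := Real.rpow_pos_of_pos hw _
  have h2 : 0 < (n : ℝ) ^ (3 / 4 : ℝ) := Real.rpow_pos_of_pos hn' _
  have h3 : 0 < Real.sqrt (Real.pi * Real.exp 1) :=
    Real.sqrt_pos.mpr (mul_pos Real.pi_pos (Real.exp_pos 1))
  have h4 := Real.exp_pos (2 * Real.sqrt n)
  rw [amplitude, amplitude, e2, Real.exp_sub]
  nth_rewrite 1 [e3]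
  field_simp

theorem asymTo_amplitude_ratio (M : ℕ) {c : ℕ → ℝ} {u : ℕ → ℝ} {s : ℝ} {σ : ℕ → ℕ}
    (hu : AsymTo M u (mk c)) (hσ : ∀ᶠ n in Filter.atTop, (σ n : ℝ) = n + s) :
    AsymTo M (fun n => u (σ n) * ((1 + s * scale n ^ 2) ^ (1 / 4 : ℝ) *
        Real.exp (2 * Real.sqrt (n + s) - 2 * Real.sqrt n)))
      (∑ j ∈ Finset.range M, C (c j) * X ^ j *
        (onePlusSq s ((1 - 2 * (j : ℝ)) / 4) * expOf (exponent s))) := by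
  rcases Nat.eq_zero_or_pos M with rfl | hM
  · have := (asymTo_onePlusSq 0 s (1 / 4)).mul
      ((asymTo_sqrt_sub 1 s).exp (constantCoeff_exponent s) one_pos |>.mono (Nat.zero_le 1))
    exact ((hu.comp_shift hσ).mul this).congr_coeff fun k hk => absurd hk (Nat.not_lt_zero k)
  have h := (hu.comp_shift hσ).mul ((asymTo_onePlusSq M s (1 / 4)).mul
    ((asymTo_sqrt_sub M s).exp (constantCoeff_exponent s) hM))
  refine h.congr_coeff fun k _ => congrArg (coeff k) ?_
  rw [Finset.sum_mul]
  refine Finset.sum_congr rfl fun j _ => ?_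
  rw [show (1 - 2 * (j : ℝ)) / 4 = -j / 2 + 1 / 4 by ring, ← onePlusSq_mul]
  ring

theorem eventually_cast_succ :
    ∀ᶠ n : ℕ in Filter.atTop, ((n + 1 : ℕ) : ℝ) = n + 1 :=
  Filter.Eventually.of_forall fun n => by push_cast; ring

theorem eventually_cast_pred :
    ∀ᶠ n : ℕ in Filter.atTop, ((n - 1 : ℕ) : ℝ) = n + (-1) := by
  filter_upwards [Filter.eventually_ge_atTop 1] with n hn
  rw [Nat.cast_sub hn]
  push_cast
  ring

/-- Divided by `n * amplitude n`, the recurrence of `a` equates two functions of `n` with known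
expansions; their coefficients of `h^{m+3}` agree. -/
theorem recurrence_of_isExpansionOfA {c : ℕ → ℝ} (hA : IsExpansionOfA c) (m : ℕ) :
    (m : ℝ) * c m = coeff (m + 3) (∑ j ∈ Finset.range m, C (c j) * X ^ j * symShift j) := by
  apply recurrence_of_coeff_eq
  set u : ℕ → ℝ := fun n => a n / amplitude n with hu'
  have hu : AsymTo (m + 4) u (mk c) := HasPoincareExpansion.asymTo hA (by omega)
  have hau : ∀ n : ℕ, 0 < n → a n = u n * amplitude n := fun n hn =>
    (div_mul_cancel₀ _ (amplitude_pos (by exact_mod_cast hn)).ne').symm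
  have h1 := (asymTo_amplitude_ratio (m + 4) hu eventually_cast_succ).add
    (asymTo_amplitude_ratio (m + 4) hu eventually_cast_pred)
  have h2 := ((AsymTo.const (m + 4) 2).add (AsymTo.scale_pow (m + 4) 2)).mul hu
  rw [map_ofNat] at h2
  have h3 := h1.congr' (G := fun n => (2 + scale n ^ 2) * u n) ?_
  · have := h3.coeff_eq h2 (show m + 3 < m + 4 by omega)
    rw [← this, ← Finset.sum_add_distrib]
    congr 1
    refine Finset.sum_congr rfl fun j _ => ?_
    rw [symShift, Finset.sum_pair (show (1 : ℝ) ≠ -1 by norm_num)]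
    ring
  · filter_upwards [eventually_cast_pred, Filter.eventually_ge_atTop 2] with n hp hn
    have hn0 : 0 < n := by omega
    have hn' : (2 : ℝ) ≤ n := by exact_mod_cast hn
    have hg : amplitude n ≠ 0 := (amplitude_pos (by linarith)).ne'
    have s1 := amplitude_shift (s := 1) hn0 (by linarith)
    have s2 := amplitude_shift (s := -1) hn0 (by linarith)
    have r := a_recurrence (n - 1)
    rw [show n - 1 + 2 = n + 1 by omega, show n - 1 + 1 = n by omega, hp, hau (n + 1) (by omega),
      hau (n - 1) (by omega), hau n hn0, hp, Nat.cast_add_one] at r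
    have hne : (n : ℝ) * amplitude n ≠ 0 := mul_ne_zero (by linarith) hg
    apply mul_left_cancel₀ hne
    have hsc : scale n ^ 2 * n = 1 := by
      rw [scale_sq]; exact inv_mul_cancel₀ (by linarith)
    linear_combination r - u (n + 1) * s1 - u (n - 1) * s2 - u n * amplitude n * hsc

theorem c_zero_nonneg {c : ℕ → ℝ} (hA : IsExpansionOfA c) : 0 ≤ c 0 := by
  have h := HasPoincareExpansion.asymTo hA (M := 1) one_pos
  rw [AsymTo] at h
  have h1 : Filter.Tendsto (fun n : ℕ => a n / amplitude n) Filter.atTop (nhds (c 0)) := by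
    rw [← tendsto_sub_nhds_zero_iff]
    refine (h.congr (fun n => ?_) fun n => pow_one _).trans_tendsto tendsto_scale
    simp [amplitude]
  refine ge_of_tendsto h1 ?_
  filter_upwards [Filter.eventually_gt_atTop 0] with n hn
  exact div_nonneg (a_nonneg n) (amplitude_pos (by exact_mod_cast hn)).le

/-- In the Casoratian the dominant exponentials cancel up to `e^{±δ}` with `δ = 2√(n+1) - 2√n = h +
⋯`. At order `h` the products with `c_1` cancel, and `2 c_0² = 2` remains. -/
theorem c_zero_sq {c : ℕ → ℝ} (hA : IsExpansionOfA c) (hB : IsExpansionOfB c) : c 0 ^ 2 = 1 := by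
  set u : ℕ → ℝ := fun n => a n / amplitude n with hu'
  set ampB : ℕ → ℝ := fun n => Real.sqrt (Real.pi * Real.exp 1) /
    ((n : ℝ) ^ (3 / 4 : ℝ) * Real.exp (2 * Real.sqrt n)) with hampB
  set v : ℕ → ℝ := fun n => b n / (-ampB n) with hv'
  have hu : AsymTo 2 u (mk c) := HasPoincareExpansion.asymTo hA two_pos
  have hv : AsymTo 2 v (mk fun m => (-1) ^ m * c m) := HasPoincareExpansion.asymTo hB two_pos
  -- Replacing `n` by `n + 1` changes `h^k` only by a relative `O(h²)`, invisible at order 2.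
  have shift2 : ∀ {w : ℕ → ℝ} {e : ℕ → ℝ}, AsymTo 2 w (mk e) →
      AsymTo 2 (fun n => w (n + 1)) (mk e) := by
    intro w e hw
    refine (hw.comp_shift eventually_cast_succ).congr_coeff fun k hk => ?_
    interval_cases k <;>
      simp [Finset.sum_range_succ, coeff_C_mul, coeff_onePlusSq, constantCoeff_onePlusSq]
  have hK : 0 < Real.sqrt (Real.pi * Real.exp 1) :=
    Real.sqrt_pos.mpr (mul_pos Real.pi_pos (Real.exp_pos 1))
  have hδ := asymTo_sqrt_sub 2 1
  have hE := hδ.exp (constantCoeff_exponent 1) two_pos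
  have hE' := hδ.neg.exp (by rw [map_neg, constantCoeff_exponent, neg_zero]) two_pos
  have h1 := ((asymTo_onePlusSq 2 1 (1 / 4)).mul
    ((((shift2 hu).mul hv).mul hE).sub ((hu.mul (shift2 hv)).mul hE')))
  have h2 := (AsymTo.const 2 2).mul (AsymTo.scale_pow 2 1)
  have h3 := h1.congr' (G := fun n => 2 * scale n ^ 1) ?_
  · have h4 := h3.coeff_eq h2 (show 1 < 2 by norm_num)
    have e1 : coeff 1 (exponent 1) = 1 := by
      simp [exponent, divX, coeff_one, coeff_onePlusSq]
    have x1 : coeff 1 (expOf (exponent 1)) = 1 := by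
      rw [coeff_expOf (constantCoeff_exponent 1) (show 1 < 2 by norm_num)]
      simp [Finset.sum_range_succ, e1, coeff_one]
    have x2 : coeff 1 (expOf (-exponent 1)) = -1 := by
      rw [coeff_expOf (by rw [map_neg, constantCoeff_exponent, neg_zero])
        (show 1 < 2 by norm_num)]
      simp [Finset.sum_range_succ, e1, coeff_one]
    have y1 : constantCoeff (expOf (exponent 1)) = 1 :=
      constantCoeff_expOf (constantCoeff_exponent 1)
    have y2 : constantCoeff (expOf (-exponent 1)) = 1 :=
      constantCoeff_expOf (by rw [map_neg, constantCoeff_exponent, neg_zero])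
    have z1 : coeff 1 (onePlusSq 1 (1 / 4)) = 0 := by simp [coeff_onePlusSq]
    rw [coeff_mul, coeff_C_mul] at h4
    simp [Finset.Nat.antidiagonal_succ, coeff_mul, x1, x2, y1, y2,
      constantCoeff_onePlusSq] at h4
    linarith
  · filter_upwards [Filter.eventually_gt_atTop 0] with n hn
    have hn' : (0 : ℝ) < n := by exact_mod_cast hn
    have hW := casoratian hn
    have hau : ∀ n : ℕ, 0 < n → a n = u n * amplitude n := fun n hn =>
      (div_mul_cancel₀ _ (amplitude_pos (by exact_mod_cast hn)).ne').symm
    have hbv : ∀ n : ℕ, 0 < n → b n = v n * (-ampB n) := fun n hn => by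
      have : (0 : ℝ) < n := by exact_mod_cast hn
      have : ampB n ≠ 0 := by positivity
      exact (div_mul_cancel₀ _ (neg_ne_zero.mpr this)).symm
    rw [hau n hn, hau (n + 1) n.succ_pos, hbv n hn, hbv (n + 1) n.succ_pos] at hW
    have hn1 : (0 : ℝ) < (n + 1 : ℕ) := by positivity
    have hcast : ((n + 1 : ℕ) : ℝ) = n + 1 := Nat.cast_succ n
    have hp : 0 < (n : ℝ) ^ (3 / 4 : ℝ) := Real.rpow_pos_of_pos hn' _
    have hq : 0 < ((n + 1 : ℕ) : ℝ) ^ (3 / 4 : ℝ) := Real.rpow_pos_of_pos hn1 _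
    have hw : 0 < 1 + 1 * scale n ^ 2 := by positivity
    have hnw : ((n + 1 : ℕ) : ℝ) = n * (1 + 1 * scale n ^ 2) := by
      rw [scale_sq, hcast]; field_simp
    -- Turns the Casoratian weight `n(n+1)` and the two amplitude powers into the single factor `h`,
    -- up to `(1 + h²)^{1/4}`.
    have hkey : (n : ℝ) * (n + 1 : ℕ) * scale n = (n : ℝ) ^ (3 / 4 : ℝ) *
        ((n + 1 : ℕ) : ℝ) ^ (3 / 4 : ℝ) * (1 + 1 * scale n ^ 2) ^ (1 / 4 : ℝ) := by
      have k1 : (1 + 1 * scale n ^ 2) ^ (3 / 4 : ℝ) * (1 + 1 * scale n ^ 2) ^ (1 / 4 : ℝ) =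
          1 + 1 * scale n ^ 2 := by
        rw [← Real.rpow_add hw]; norm_num
      have k2 : (n : ℝ) ^ (3 / 4 : ℝ) * (n : ℝ) ^ (3 / 4 : ℝ) = n * Real.sqrt n := by
        rw [Real.sqrt_eq_rpow, ← Real.rpow_add hn', ← Real.rpow_one_add' hn'.le (by norm_num)]
        norm_num
      have k3 : (n : ℝ) * scale n = Real.sqrt n := by
        rw [scale, ← div_eq_mul_inv, Real.div_sqrt]
      rw [hnw, Real.mul_rpow hn'.le hw.le]
      linear_combination (n : ℝ) * (1 + 1 * scale n ^ 2) * k3 - (n : ℝ) ^ (3 / 4 : ℝ) *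
        (n : ℝ) ^ (3 / 4 : ℝ) * k1 - (1 + 1 * scale n ^ 2) * k2
    have hx := Real.exp_pos (2 * Real.sqrt n)
    have hy := Real.exp_pos (2 * Real.sqrt (n + 1 : ℕ))
    have hW' : (n : ℝ) * (n + 1 : ℕ) * (u (n + 1) * v n *
        (Real.exp (2 * Real.sqrt (n + 1 : ℕ)) / Real.exp (2 * Real.sqrt n)) - u n * v (n + 1) *
        (Real.exp (2 * Real.sqrt n) / Real.exp (2 * Real.sqrt (n + 1 : ℕ)))) =
        2 * ((n : ℝ) ^ (3 / 4 : ℝ) * ((n + 1 : ℕ) : ℝ) ^ (3 / 4 : ℝ)) := by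
      rw [← hcast] at hW
      simp only [amplitude, hampB] at hW
      generalize ((n + 1 : ℕ) : ℝ) ^ (3 / 4 : ℝ) = q at *
      generalize (n : ℝ) ^ (3 / 4 : ℝ) = p at *
      generalize Real.exp (2 * Real.sqrt (n + 1 : ℕ)) = y at *
      generalize Real.exp (2 * Real.sqrt n) = x at *
      generalize Real.sqrt (Real.pi * Real.exp 1) = K at *
      generalize ((n + 1 : ℕ) : ℝ) = n' at *
      clear hu' hv' hampB hkey
      clear_value u v
      field_simp at hW ⊢
      linear_combination hW
    rw [neg_sub, Real.exp_sub, Real.exp_sub, ← hcast, pow_one]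
    have hpq := (mul_pos hp hq).ne'
    apply mul_left_cancel₀ hpq
    rw [← mul_assoc, ← hkey]
    linear_combination scale n * hW'

end ExpIntegral

end

theorem lemma3 (c : ℕ → ℝ)
    (hc : (∀ m : ℕ, c m = ExpIntegral.cDirect m) ∨
      (ExpIntegral.IsExpansionOfA c ∧ ExpIntegral.IsExpansionOfB c)) :
    c 0 = 1 ∧
    ∀ m : ℕ, 1 ≤ m →
      (m : ℝ) * c m =
        PowerSeries.coeff (m + 3)
          (∑ j ∈ Finset.range m,
            PowerSeries.C (c j) * (PowerSeries.X : PowerSeries ℝ) ^ j *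
              ∑ s ∈ ({1, -1} : Finset ℝ),
                ExpIntegral.onePlusSq s ((1 - 2 * (j : ℝ)) / 4) *
                  ExpIntegral.expOf (ExpIntegral.exponent s)) := by
  rcases hc with hc | ⟨hA, hB⟩
  · obtain rfl : c = ExpIntegral.cDirect := funext hc
    exact ⟨ExpIntegral.cDirect_zero, fun m _ => ExpIntegral.cDirect_recurrence m⟩
  · refine ⟨?_, fun m _ => ExpIntegral.recurrence_of_isExpansionOfA hA m⟩
    have h1 := ExpIntegral.c_zero_sq hA hB
    have h2 := ExpIntegral.c_zero_nonneg hA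
    nlinarith
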